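/- Let $N\ge 1$ be an integer, $0<m<1$, $0<\rho_0<\rho_1$, $L>0$, $M>0$, and put $p=\frac{2(1+m)+N(1-m)}{1-m}$. For $x_0\in\mathbb{R}^N$ and $\rho>0$ let $B(x_0,\rho)$ be the open ball, $\mathbb{S}(x_0,\rho)$ its boundary, $\sigma$ the surface measure on the sphere, and $r_+=\max\{0,r\}$. Then there exist functions $E_\star,\varepsilon_\star:[0,\infty]\to(0,\infty)$, depending only on $N,m,\rho_0,\rho_1,L,M$ and non-increasing on $[0,\infty)$, with the following property. Let $x_0\in\mathbb{R}^N$, let $F\in L^2(B(x_0,\rho_1);\mathbb{C})$ and let $u\in H^1_{\mathrm{loc}}(B(x_0,\rho_1);\mathbb{C})$ be such that for almost every $\rho\in(0,\rho_1)$, $$\|\nabla u\|_{L^2(B(x_0,\rho))}^2+L\|u\|_{L^{m+1}(B(x_0,\rho))}^{m+1}+L\|u\|_{L^2(B(x_0,\rho))}^2\le M\left(\left|\int_{\mathbb{S}(x_0,\rho)}u\,\overline{\nabla u}\cdot\frac{x-x_0}{|x-x_0|}\,d\sigma\right|+\int_{B(x_0,\rho)}|F(x)u(x)|\,dx\right).$$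 Set $s=\|u\|_{L^{m+1}(B(x_0,\rho_1))}\in[0,\infty]$. If $\|\nabla u\|_{L^2(B(x_0,\rho_1))}^2<E_\star(s)$ and $$\|F\|_{L^2(B(x_0,\rho))}^2\le\varepsilon_\star(s)\,\big((\rho-\rho_0)_+\big)^p\qquad\text{for all }\rho\in(0,\rho_1),$$ then $u=0$ almost everywhere on $B(x_0,\rho_0)$. -/

import Mathlib

open MeasureTheory Metric Set
open scoped ENNReal NNReal ContDiff ComplexConjugate

/-- `f ∈ L²_loc(Ω)`: `f` is square integrable on every compact subset of `Ω`. -/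
def MemL2Loc {N : ℕ} {V : Type*} [NormedAddCommGroup V]
    (Ω : Set (EuclideanSpace ℝ (Fin N))) (f : EuclideanSpace ℝ (Fin N) → V) : Prop :=
  ∀ K : Set (EuclideanSpace ℝ (Fin N)), IsCompact K → K ⊆ Ω → MemLp f 2 (volume.restrict K)

/-- `G` is the weak (distributional) gradient of the complex-valued function `u` in `Ω`:
`∫_Ω u ∂ᵢφ dx = - ∫_Ω Gᵢ φ dx` for all test functions `φ ∈ C_c^∞(Ω)` and all `i`. -/
def IsWeakGradient {N : ℕ} (Ω : Set (EuclideanSpace ℝ (Fin N)))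
    (u : EuclideanSpace ℝ (Fin N) → ℂ)
    (G : EuclideanSpace ℝ (Fin N) → EuclideanSpace ℂ (Fin N)) : Prop :=
  ∀ φ : EuclideanSpace ℝ (Fin N) → ℝ, ContDiff ℝ ∞ φ → HasCompactSupport φ → tsupport φ ⊆ Ω →
    ∀ i : Fin N,
      ∫ x in Ω, fderiv ℝ φ x (EuclideanSpace.single i 1) • u x = - ∫ x in Ω, φ x • G x i

/-- `u ∈ H¹_loc(Ω)` with (almost everywhere unique) weak gradient `G = ∇u`. -/
structure IsH1Loc {N : ℕ} (Ω : Set (EuclideanSpace ℝ (Fin N)))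
    (u : EuclideanSpace ℝ (Fin N) → ℂ)
    (G : EuclideanSpace ℝ (Fin N) → EuclideanSpace ℂ (Fin N)) : Prop where
  memL2Loc : MemL2Loc Ω u
  grad_memL2Loc : MemL2Loc Ω G
  isWeakGradient : IsWeakGradient Ω u G

/-- The integral `∫_{S(x₀,ρ)} g dσ` with respect to the surface measure of the sphere of centre
`x₀` and radius `ρ > 0` in `ℝ^N`, `N ≥ 1`. It is written over the unit sphere, whose surface
measure is `volume.toSphere` (for `N = 1` this is the counting measure on `{-1, 1}`). -/
noncomputable def sphereIntegral {N : ℕ} (x₀ : EuclideanSpace ℝ (Fin N)) (ρ : ℝ)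
    (g : EuclideanSpace ℝ (Fin N) → ℂ) : ℂ :=
  (ρ ^ (N - 1) : ℝ) •
    ∫ ξ : sphere (0 : EuclideanSpace ℝ (Fin N)) 1,
      g (x₀ + ρ • (ξ : EuclideanSpace ℝ (Fin N)))
        ∂(volume : Measure (EuclideanSpace ℝ (Fin N))).toSphere

/-- The flux `∫_{S(x₀,ρ)} u conj(∇u) · (x - x₀)/|x - x₀| dσ`, where `G = ∇u`. -/
noncomputable def boundaryFlux {N : ℕ} (u : EuclideanSpace ℝ (Fin N) → ℂ)
    (G : EuclideanSpace ℝ (Fin N) → EuclideanSpace ℂ (Fin N))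
    (x₀ : EuclideanSpace ℝ (Fin N)) (ρ : ℝ) : ℂ :=
  sphereIntegral x₀ ρ fun x => u x * ∑ i, conj (G x i) * (((x - x₀) i / ‖x - x₀‖ : ℝ) : ℂ)

/-- The norm `‖f‖_{L^q(B(x₀,ρ))}`, with values in `[0,∞]`, for a real exponent `q > 0`. -/
noncomputable def ballNorm {N : ℕ} {V : Type*} [NormedAddCommGroup V]
    (f : EuclideanSpace ℝ (Fin N) → V) (q : ℝ) (x₀ : EuclideanSpace ℝ (Fin N)) (ρ : ℝ) : ℝ≥0∞ :=
  eLpNorm f (ENNReal.ofReal q) (volume.restrict (ball x₀ ρ))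

/-- The local energy inequality at radius `ρ`, where `G = ∇u`:
`‖∇u‖²_{L²(B(x₀,ρ))} + L ‖u‖^{m+1}_{L^{m+1}(B(x₀,ρ))} + L ‖u‖²_{L²(B(x₀,ρ))}
  ≤ M (|∫_{S(x₀,ρ)} u conj(∇u) · (x - x₀)/|x - x₀| dσ| + ∫_{B(x₀,ρ)} |F u| dx)`. -/
def LocalEnergyInequality {N : ℕ} (m L M : ℝ) (F u : EuclideanSpace ℝ (Fin N) → ℂ)
    (G : EuclideanSpace ℝ (Fin N) → EuclideanSpace ℂ (Fin N))
    (x₀ : EuclideanSpace ℝ (Fin N)) (ρ : ℝ) : Prop :=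
  ballNorm G 2 x₀ ρ ^ 2 + ENNReal.ofReal L * ballNorm u (m + 1) x₀ ρ ^ (m + 1)
      + ENNReal.ofReal L * ballNorm u 2 x₀ ρ ^ 2
    ≤ ENNReal.ofReal M * (‖boundaryFlux u G x₀ ρ‖ₑ + ∫⁻ x in ball x₀ ρ, ‖F x * u x‖ₑ)

/-! Write `E`, `b`, `c` for the integrals of |∇u|², |u|^(1+m), |u|² over the ball of radius ρ.
Young's inequality absorbs the source term into half of `L c`, so the energy `Q = E + L b + (L/2) c`
is bounded by `M` times the flux plus a multiple of ‖F‖². The energy increases with the radius, so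
integrating in the radius over (r, R), passing to polar coordinates and using Cauchy-Schwarz give
(`ballEnergy_mul_sub_le`) (R - r) Q(r) ≤ M √(c(R) E(R)) + M²/(2L) (R - r) ‖F‖²_{L²(B_R)}. No
differential inequality for the energy is needed.

The gain comes from interpolation (`IsH1Loc.setLIntegral_sq_le`): for every scale δ ≤ 1/2, c ≤ C₁ δ²
E + C₂ (δ^(-N) b)^((1-m)/(1+m)) b. It is proved by comparing u(x) with the average of u((1-δ)x + δz)
over z in the ball. The convex combination never leaves the ball, so no extension operator is
needed. The scale δ = Q^(1/p)/2 balances the two terms; this balance determines p and yields c ≤ C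
Q^(1+2/p) (`le_energy_rpow_of_forall_scale`), hence √(cE) ≤ √C Q^(1+1/p).

The resulting inequality is superlinear in Q because m < 1. De Giorgi iteration on the radii ρ₀ + h
2^(-k) (`nonpos_of_superlinear_decay`) propagates Q ≤ η 2^(-pk). The source, of size (R - ρ₀)^p,
decays at exactly this rate. In the limit Q(ρ₀) = 0, and so u = 0 on the ball of radius ρ₀. The
starting bound Q ≤ η follows from the integrated inequality once more, since `c` is controlled by (1
+ s)² and `E` is assumed small relative to that (`exists_thresholds`). -/

open Filter Topology

/-! ### Integral inequalities and exhaustion of balls -/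

/-- Jensen's inequality for powers and Lebesgue integrals. -/
theorem lintegral_rpow_le_lintegral_rpow {α : Type*} [MeasurableSpace α] {μ : Measure α}
    [IsProbabilityMeasure μ] {f : α → ℝ≥0∞} (hf : AEMeasurable f μ) {q : ℝ} (hq : 1 ≤ q) :
    (∫⁻ x, f x ∂μ) ^ q ≤ ∫⁻ x, f x ^ q ∂μ := by
  have h := eLpNorm'_le_eLpNorm'_of_exponent_le (f := f) one_pos hq μ hf.aestronglyMeasurable
  simp only [eLpNorm', enorm_eq_self, ENNReal.rpow_one, div_one, one_div] at h
  exact (ENNReal.le_rpow_inv_iff (by linarith)).1 h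

theorem lintegral_sq_le_lintegral_sq {α : Type*} [MeasurableSpace α] {μ : Measure α}
    [IsProbabilityMeasure μ] {f : α → ℝ≥0∞} (hf : AEMeasurable f μ) :
    (∫⁻ x, f x ∂μ) ^ 2 ≤ ∫⁻ x, f x ^ 2 ∂μ := by
  simpa using lintegral_rpow_le_lintegral_rpow hf one_le_two

/-- The Cauchy-Schwarz inequality for Lebesgue integrals. -/
theorem sq_lintegral_mul_le {α : Type*} [MeasurableSpace α] {μ : Measure α}
    {f g : α → ℝ≥0∞} (hf : AEMeasurable f μ) (hg : AEMeasurable g μ) :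
    (∫⁻ x, f x * g x ∂μ) ^ 2 ≤ (∫⁻ x, f x ^ 2 ∂μ) * ∫⁻ x, g x ^ 2 ∂μ := by
  have h := ENNReal.lintegral_mul_le_Lp_mul_Lq μ Real.HolderConjugate.two_two hf hg
  calc (∫⁻ x, f x * g x ∂μ) ^ 2
      ≤ ((∫⁻ x, f x ^ (2 : ℝ) ∂μ) ^ (1 / 2 : ℝ) * (∫⁻ x, g x ^ (2 : ℝ) ∂μ) ^ (1 / 2 : ℝ)) ^ 2 := by
        gcongr; exact h
    _ = _ := by
        rw [mul_pow, ← ENNReal.rpow_natCast, ← ENNReal.rpow_natCast, ← ENNReal.rpow_mul,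
          ← ENNReal.rpow_mul]
        simp

/-- The set integral over an open ball is the limit of those over the smaller balls. -/
theorem setLIntegral_ball_le_of_forall_lt {X : Type*} [PseudoMetricSpace X] [MeasurableSpace X]
    {μ : Measure X} {f : X → ℝ≥0∞} {x : X} {R : ℝ} {C : ℝ≥0∞}
    (h : ∀ r < R, ∫⁻ y in ball x r, f y ∂μ ≤ C) : ∫⁻ y in ball x R, f y ∂μ ≤ C := by
  have hU : ball x R = ⋃ n : ℕ, ball x (R - 1 / (n + 1)) := by
    ext y
    simp only [mem_ball, mem_iUnion]
    constructor
    · intro hy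
      obtain ⟨n, hn⟩ := exists_nat_one_div_lt (sub_pos.2 hy)
      exact ⟨n, by linarith⟩
    · rintro ⟨n, hn⟩
      have : (0 : ℝ) < 1 / (n + 1) := Nat.one_div_pos_of_nat
      linarith
  have hmono : Monotone fun n : ℕ => ball x (R - 1 / (n + 1)) := by
    intro n k hnk
    refine ball_subset_ball (sub_le_sub_left ?_ _)
    exact Nat.one_div_le_one_div hnk
  rw [hU, setLIntegral_iUnion_of_directed _ hmono.directed_le]
  exact iSup_le fun n => h _ (sub_lt_self _ Nat.one_div_pos_of_nat)

/-! ### Affine changes of variables and polar coordinates -/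

section Haar

variable {E : Type*} [NormedAddCommGroup E] [NormedSpace ℝ E] [MeasurableSpace E] [BorelSpace E]
  [FiniteDimensional ℝ E] (μ : Measure E) [μ.IsAddHaarMeasure]

theorem lintegral_comp_smul_add (f : E → ℝ≥0∞) {a : ℝ} (ha : 0 < a) (c : E) :
    ∫⁻ x, f (a • x + c) ∂μ =
      ENNReal.ofReal ((a ^ Module.finrank ℝ E)⁻¹) * ∫⁻ x, f x ∂μ := by
  have h := (Homeomorph.smulOfNeZero a ha.ne' : E ≃ₜ E).measurableEmbedding.lintegral_map
    (μ := μ) (fun x => f (x + c))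
  have h' : ((Homeomorph.smulOfNeZero a ha.ne' : E ≃ₜ E) : E → E) = fun x => a • x := rfl
  rw [h'] at h
  rw [← h, Measure.map_addHaar_smul μ ha.ne', lintegral_smul_measure,
    lintegral_add_right_eq_self, abs_of_pos (by positivity), smul_eq_mul]

theorem setLIntegral_comp_smul_add_le (f : E → ℝ≥0∞) {a : ℝ} (ha : 0 < a) (c : E) {s t : Set E}
    (hs : MeasurableSet s) (ht : MeasurableSet t) (hst : ∀ x ∈ s, a • x + c ∈ t) :
    ∫⁻ x in s, f (a • x + c) ∂μ ≤
      ENNReal.ofReal ((a ^ Module.finrank ℝ E)⁻¹) * ∫⁻ x in t, f x ∂μ := by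
  rw [← lintegral_indicator hs, ← lintegral_indicator ht,
    ← lintegral_comp_smul_add μ (t.indicator f) ha c]
  refine lintegral_mono fun x => ?_
  by_cases hx : x ∈ s
  · simp [hx, hst x hx]
  · simp [hx]

/-- Integration in polar coordinates. -/
theorem lintegral_eq_lintegral_Ioi_toSphere [Nontrivial E] {f : E → ℝ≥0∞} (hf : AEMeasurable f μ) :
    ∫⁻ x, f x ∂μ = ∫⁻ ρ in Ioi (0 : ℝ), ENNReal.ofReal (ρ ^ (Module.finrank ℝ E - 1)) *
      ∫⁻ ξ : sphere (0 : E) 1, f (ρ • (ξ : E)) ∂μ.toSphere := by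
  have hmp := μ.measurePreserving_homeomorphUnitSphereProd
  have hme := (homeomorphUnitSphereProd E).measurableEmbedding
  set g : sphere (0 : E) 1 × Ioi (0 : ℝ) → ℝ≥0∞ := fun p => f ((p.2 : ℝ) • (p.1 : E)) with hg
  have hgf : ∀ x : ({0}ᶜ : Set E), g (homeomorphUnitSphereProd E x) = f x := by
    intro x
    have : ‖(x : E)‖ ≠ 0 := norm_ne_zero_iff.2 x.2
    simp [hg, smul_smul, this]
  have hfc : AEMeasurable (fun x : ({0}ᶜ : Set E) => f x) (μ.comap (↑)) :=
    (aemeasurable_restrict_iff_comap_subtype (measurableSet_singleton (0 : E)).compl).1 hf.restrict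
  have hgm : AEMeasurable g (μ.toSphere.prod (.volumeIoiPow (Module.finrank ℝ E - 1))) := by
    rw [← hmp.map_eq, hme.aemeasurable_map_iff]
    exact hfc.congr (.of_forall fun x => (hgf x).symm)
  calc ∫⁻ x, f x ∂μ = ∫⁻ x in ({0}ᶜ : Set E), f x ∂μ := by rw [restrict_compl_singleton]
    _ = ∫⁻ x : ({0}ᶜ : Set E), f x ∂(μ.comap (↑)) :=
        (lintegral_subtype_comap (measurableSet_singleton _).compl _).symm
    _ = ∫⁻ p, g p ∂(μ.toSphere.prod (.volumeIoiPow (Module.finrank ℝ E - 1))) := by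
        rw [← hmp.lintegral_comp_emb hme]
        simp only [hgf]
    _ = ∫⁻ ρ : Ioi (0 : ℝ), ∫⁻ ξ, g (ξ, ρ) ∂μ.toSphere
          ∂(.volumeIoiPow (Module.finrank ℝ E - 1)) := by
        rw [lintegral_prod_symm _ hgm]
    _ = _ := by
        -- Since f is only a.e. measurable, its spherical integral need not be measurable in the
        -- radius. A finite density makes this unnecessary.
        rw [Measure.volumeIoiPow, lintegral_withDensity_eq_lintegral_mul_non_measurable _
            (by fun_prop) (.of_forall fun _ => ENNReal.ofReal_lt_top),
          ← lintegral_subtype_comap measurableSet_Ioi (fun ρ : ℝ =>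
            ENNReal.ofReal (ρ ^ (Module.finrank ℝ E - 1)) *
            ∫⁻ ξ : sphere (0 : E) 1, f (ρ • (ξ : E)) ∂μ.toSphere)]
        rfl

end Haar

/-! ### Contraction toward a point: smooth functions -/

theorem smul_add_mem_ball {E : Type*} [NormedAddCommGroup E] [NormedSpace ℝ E] {x₀ x z : E}
    {r t : ℝ} (hx : x ∈ ball x₀ r) (hz : z ∈ ball x₀ r)
    (h0 : 0 ≤ t) (h1 : t ≤ 1) : (1 - t) • x + t • z ∈ ball x₀ r :=
  convex_ball x₀ r hx hz (by linarith) h0 (by ring)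

theorem enorm_sub_le_lintegral_fderiv {E : Type*} [NormedAddCommGroup E] [NormedSpace ℝ E]
    {v : E → ℂ} (hv : ContDiff ℝ 1 v) (x z : E) (δ : ℝ) :
    ‖v x - v ((1 - δ) • x + δ • z)‖ₑ ≤
      ∫⁻ s in Ioc (0 : ℝ) 1,
        ‖δ • (z - x)‖ₑ * ‖fderiv ℝ v ((1 - s * δ) • x + (s * δ) • z)‖ₑ := by
  have hγ : ∀ s : ℝ, HasDerivAt (fun s : ℝ => v ((1 - s * δ) • x + (s * δ) • z))
      (fderiv ℝ v ((1 - s * δ) • x + (s * δ) • z) (δ • (z - x))) s := by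
    intro s
    have h1 : HasDerivAt (fun s : ℝ => (1 - s * δ) • x + (s * δ) • z) (δ • (z - x)) s := by
      have ha : HasDerivAt (fun s : ℝ => s * δ) δ s := by
        simpa using (hasDerivAt_id s).mul_const δ
      have := ((ha.const_sub 1).smul_const x).add (ha.smul_const z)
      refine this.congr_deriv ?_
      module
    exact ((hv.differentiable one_ne_zero _).hasFDerivAt).comp_hasDerivAt s h1
  have hc : Continuous fun s : ℝ =>
      fderiv ℝ v ((1 - s * δ) • x + (s * δ) • z) (δ • (z - x)) := by
    have := hv.continuous_fderiv one_ne_zero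
    fun_prop
  have h := intervalIntegral.integral_eq_sub_of_hasDerivAt (a := 0) (b := 1)
    (fun s _ => hγ s) (hc.intervalIntegrable _ _)
  rw [intervalIntegral.integral_of_le zero_le_one] at h
  simp only [one_mul, zero_mul, sub_zero, one_smul, zero_smul, add_zero] at h
  rw [← enorm_neg, neg_sub, ← h]
  refine (enorm_integral_le_lintegral_enorm _).trans (lintegral_mono fun s => ?_)
  rw [mul_comm ‖δ • (z - x)‖ₑ]
  exact ContinuousLinearMap.le_opENorm _ _

section Haar

variable {E : Type*} [NormedAddCommGroup E] [NormedSpace ℝ E] [MeasurableSpace E] [BorelSpace E]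
  [FiniteDimensional ℝ E] (μ : Measure E) [μ.IsAddHaarMeasure]

theorem quasiMeasurePreserving_smul_add {a : ℝ} (ha : 0 < a) (c : E) :
    Measure.QuasiMeasurePreserving (fun x : E => a • x + c) μ μ := by
  refine ⟨by fun_prop, Measure.AbsolutelyContinuous.mk fun s hs h0 => ?_⟩
  rw [Measure.map_apply (by fun_prop) hs, ← lintegral_indicator_one (by measurability)]
  have h := lintegral_comp_smul_add μ (s.indicator 1) ha c
  rw [lintegral_indicator_one hs, h0, mul_zero] at h
  exact h

theorem ofReal_inv_pow_le {a : ℝ} (ha : 1 / 2 ≤ a) (n : ℕ) :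
    ENNReal.ofReal ((a ^ n)⁻¹) ≤ 2 ^ n := by
  have h : (a ^ n)⁻¹ ≤ 2 ^ n := by
    rw [← inv_pow]
    have : a⁻¹ ≤ 2 := by
      rw [inv_le_comm₀ (by linarith) (by norm_num)]; linarith
    have : 0 ≤ a⁻¹ := inv_nonneg.2 (by linarith)
    gcongr
  calc _ ≤ ENNReal.ofReal (2 ^ n) := ENNReal.ofReal_le_ofReal h
    _ = 2 ^ n := by rw [ENNReal.ofReal_pow (by norm_num)]; simp

/-- The difference is the integral of the derivative along the segment from x toward z, of length at
most 2rδ. After Jensen and Tonelli, each intermediate map x ↦ (1 - sδ)x + sδz sends the ball into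
itself with ratio at least 1/2, so its Jacobian costs at most 2^N. -/
theorem setLIntegral_sub_sq_le_of_contDiff {v : E → ℂ} (hv : ContDiff ℝ 1 v) {x₀ z : E} {r δ : ℝ}
    (hz : z ∈ ball x₀ r) (h0 : 0 ≤ δ) (h1 : δ ≤ 1 / 2) :
    ∫⁻ x in ball x₀ r, ‖v x - v ((1 - δ) • x + δ • z)‖ₑ ^ 2 ∂μ ≤
      ENNReal.ofReal (2 * r * δ) ^ 2 * 2 ^ Module.finrank ℝ E *
        ∫⁻ x in ball x₀ r, ‖fderiv ℝ v x‖ₑ ^ 2 ∂μ := by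
  have hr : 0 < r := pos_of_mem_ball hz
  have hcont := hv.continuous_fderiv one_ne_zero
  have : IsProbabilityMeasure ((volume : Measure ℝ).restrict (Ioc 0 1)) := ⟨by simp⟩
  have hpt : ∀ x ∈ ball x₀ r, ‖v x - v ((1 - δ) • x + δ • z)‖ₑ ^ 2 ≤
      ∫⁻ s in Ioc (0 : ℝ) 1, ENNReal.ofReal (2 * r * δ) ^ 2 *
        ‖fderiv ℝ v ((1 - s * δ) • x + (s * δ) • z)‖ₑ ^ 2 := by
    intro x hx
    have hzx : ‖δ • (z - x)‖ₑ ≤ ENNReal.ofReal (2 * r * δ) := by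
      rw [← ofReal_norm, norm_smul, Real.norm_of_nonneg h0]
      refine ENNReal.ofReal_le_ofReal ?_
      have : ‖z - x‖ ≤ 2 * r := by
        rw [← dist_eq_norm]
        have := dist_triangle_right z x x₀
        rw [mem_ball] at hx hz
        linarith
      nlinarith
    calc _ ≤ (∫⁻ s in Ioc (0 : ℝ) 1, ENNReal.ofReal (2 * r * δ) *
          ‖fderiv ℝ v ((1 - s * δ) • x + (s * δ) • z)‖ₑ) ^ 2 := by
          gcongr
          refine (enorm_sub_le_lintegral_fderiv hv x z δ).trans ?_
          gcongr
      _ ≤ _ := by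
          refine (lintegral_sq_le_lintegral_sq ?_).trans_eq ?_
          · fun_prop
          · simp only [mul_pow]
  calc _ ≤ ∫⁻ x in ball x₀ r, ∫⁻ s in Ioc (0 : ℝ) 1, ENNReal.ofReal (2 * r * δ) ^ 2 *
        ‖fderiv ℝ v ((1 - s * δ) • x + (s * δ) • z)‖ₑ ^ 2 ∂volume ∂μ :=
        setLIntegral_mono' measurableSet_ball hpt
    _ = ∫⁻ s in Ioc (0 : ℝ) 1, ∫⁻ x in ball x₀ r, ENNReal.ofReal (2 * r * δ) ^ 2 *
        ‖fderiv ℝ v ((1 - s * δ) • x + (s * δ) • z)‖ₑ ^ 2 ∂μ := by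
        refine lintegral_lintegral_swap (Measurable.aemeasurable ?_)
        have : Continuous fun p : E × ℝ =>
            fderiv ℝ v ((1 - p.2 * δ) • p.1 + (p.2 * δ) • z) := by fun_prop
        exact (this.enorm.measurable.pow_const 2).const_mul _
    _ ≤ ∫⁻ s in Ioc (0 : ℝ) 1, ENNReal.ofReal (2 * r * δ) ^ 2 * 2 ^ Module.finrank ℝ E *
        ∫⁻ x in ball x₀ r, ‖fderiv ℝ v x‖ₑ ^ 2 ∂μ := by
        refine setLIntegral_mono' measurableSet_Ioc fun s hs => ?_
        have hs0 : 0 ≤ s * δ := mul_nonneg hs.1.le h0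
        have hs1 : s * δ ≤ 1 / 2 := by nlinarith [hs.2, hs.1]
        rw [lintegral_const_mul _ (by fun_prop), mul_assoc (ENNReal.ofReal (2 * r * δ) ^ 2)]
        gcongr
        refine (setLIntegral_comp_smul_add_le μ (fun y => ‖fderiv ℝ v y‖ₑ ^ 2)
          (by linarith) _ measurableSet_ball measurableSet_ball
          fun x hx => smul_add_mem_ball hx hz hs0 (by linarith)).trans ?_
        gcongr
        exact ofReal_inv_pow_le (by linarith) _
    _ = _ := by simp

end Haar

/-! ### Mollification and weak gradients -/

open scoped Convolution in
/-- The mollification of `u` by a smooth normalised bump function. -/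
noncomputable def mollify {N : ℕ} (φ : ContDiffBump (0 : EuclideanSpace ℝ (Fin N)))
    (u : EuclideanSpace ℝ (Fin N) → ℂ) : EuclideanSpace ℝ (Fin N) → ℂ :=
  (φ.normed volume ⋆[ContinuousLinearMap.lsmul ℝ ℝ, volume] u)

section Mollify

variable {N : ℕ} {φ : ContDiffBump (0 : EuclideanSpace ℝ (Fin N))}
  {u : EuclideanSpace ℝ (Fin N) → ℂ} {G : EuclideanSpace ℝ (Fin N) → EuclideanSpace ℂ (Fin N)}
  {x₀ : EuclideanSpace ℝ (Fin N)} {r R : ℝ}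

theorem contDiff_mollify (hu : LocallyIntegrable u) : ContDiff ℝ 1 (mollify φ u) :=
  (φ.hasCompactSupport_normed (μ := volume)).contDiff_convolution_left (n := 1) _
    φ.contDiff_normed hu

theorem fderiv_mollify_apply (hu : LocallyIntegrable u) (x w : EuclideanSpace ℝ (Fin N)) :
    fderiv ℝ (mollify φ u) x w = ∫ y, fderiv ℝ (φ.normed volume) (x - y) w • u y := by
  have h := (φ.hasCompactSupport_normed (μ := volume)).hasFDerivAt_convolution_left
    (ContinuousLinearMap.lsmul ℝ ℝ) (φ.contDiff_normed (n := 1)) hu x (μ := volume)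
  have hint := (φ.hasCompactSupport_normed (μ := volume).fderiv ℝ).convolutionExists_left
    ((ContinuousLinearMap.lsmul ℝ ℝ).precompL (EuclideanSpace ℝ (Fin N)))
    ((φ.contDiff_normed (n := 1)).continuous_fderiv one_ne_zero) hu x
  rw [mollify, h.fderiv, convolution_eq_swap, ContinuousLinearMap.integral_apply]
  · rfl
  · exact hint.integrable_swap

theorem tsupport_normed_sub_subset {x : EuclideanSpace ℝ (Fin N)} :
    tsupport (fun y => φ.normed volume (x - y)) ⊆ closedBall x φ.rOut := by
  refine closure_minimal (fun y hy => ?_) isClosed_closedBall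
  have : x - y ∈ Function.support (φ.normed volume) := hy
  rw [φ.support_normed_eq, mem_ball_zero_iff] at this
  rw [mem_closedBall, dist_eq_norm']
  exact this.le

/-- The function y ↦ φ(x - y) is an admissible test function as long as its support stays in the
ball; the sign from differentiating in y cancels the sign in the definition of the weak gradient. -/
theorem fderiv_mollify_single (hu : LocallyIntegrable u)
    (hw : IsWeakGradient (ball x₀ R) u G) {x : EuclideanSpace ℝ (Fin N)}
    (hx : closedBall x φ.rOut ⊆ ball x₀ R) (i : Fin N) :
    fderiv ℝ (mollify φ u) x (EuclideanSpace.single i 1) =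
      ∫ y, φ.normed volume (x - y) • G y i := by
  set ψ : EuclideanSpace ℝ (Fin N) → ℝ := fun y => φ.normed volume (x - y) with hψ
  have hts : tsupport ψ ⊆ ball x₀ R := tsupport_normed_sub_subset.trans hx
  have hψc : ContDiff ℝ ∞ ψ := φ.contDiff_normed.comp (contDiff_const.sub contDiff_id)
  have hcs : HasCompactSupport ψ :=
    (isCompact_closedBall x φ.rOut).of_isClosed_subset (isClosed_tsupport _)
      tsupport_normed_sub_subset
  have hfd : ∀ y w, fderiv ℝ ψ y w = - fderiv ℝ (φ.normed volume) (x - y) w := by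
    intro y w
    have h1 : HasFDerivAt (fun y => x - y)
        (-ContinuousLinearMap.id ℝ (EuclideanSpace ℝ (Fin N))) y := (hasFDerivAt_id y).const_sub x
    have h2 : HasFDerivAt ψ _ y := (((φ.contDiff_normed (n := 1) (μ := volume)).differentiable
      one_ne_zero (x - y)).hasFDerivAt).comp y h1
    rw [h2.fderiv]
    simp
  have h := hw ψ hψc hcs hts i
  rw [setIntegral_eq_integral_of_forall_compl_eq_zero,
    setIntegral_eq_integral_of_forall_compl_eq_zero] at h
  · rw [fderiv_mollify_apply hu]
    simp only [hfd, neg_smul, integral_neg, neg_inj] at h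
    exact h
  · intro y hy
    have : ψ y = 0 := image_eq_zero_of_notMem_tsupport fun h' => hy (hts h')
    simp [this]
  · intro y hy
    have : fderiv ℝ ψ y = 0 :=
      image_eq_zero_of_notMem_tsupport fun h' => hy (hts (tsupport_fderiv_subset ℝ h'))
    simp [this]

theorem fderiv_mollify_eq (hu : LocallyIntegrable u) (hG : LocallyIntegrable G)
    (hw : IsWeakGradient (ball x₀ R) u G) {x : EuclideanSpace ℝ (Fin N)}
    (hx : closedBall x φ.rOut ⊆ ball x₀ R) (w : EuclideanSpace ℝ (Fin N)) :
    fderiv ℝ (mollify φ u) x w =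
      ∫ y, φ.normed volume (x - y) • ∑ i, (w i : ℂ) * G y i := by
  have hws : w = ∑ i, w i • EuclideanSpace.single i (1 : ℝ) := by
    ext j
    simp [Finset.sum_apply, Pi.single_apply]
  have hGi : ∀ i, LocallyIntegrable fun y => G y i := fun i y => by
    obtain ⟨s, hs, h⟩ := hG y
    exact ⟨s, hs, (EuclideanSpace.proj (𝕜 := ℂ) i).integrable_comp h⟩
  have hint : ∀ i, Integrable fun y => φ.normed volume (x - y) • G y i := fun i =>
    (hGi i).integrable_smul_left_of_hasCompactSupport
      (φ.continuous_normed.comp (continuous_const.sub continuous_id))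
      ((isCompact_closedBall x φ.rOut).of_isClosed_subset (isClosed_tsupport _)
        tsupport_normed_sub_subset)
  conv_lhs => rw [hws]
  simp only [map_sum, map_smul, fderiv_mollify_single hu hw hx]
  simp only [Finset.smul_sum]
  rw [integral_finsetSum]
  · refine Finset.sum_congr rfl fun i _ => ?_
    rw [← integral_smul]
    congr with y
    simp only [Complex.real_smul]
    ring
  · intro i _
    refine ((hint i).smul (w i)).congr (.of_forall fun y => ?_)
    simp only [Pi.smul_apply, Complex.real_smul]
    ring

/-- Cauchy-Schwarz with constant one: the real-linear differential built from a complex gradient has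
operator norm at most the Euclidean norm of that gradient. -/
theorem norm_sum_ofReal_mul_le (w : EuclideanSpace ℝ (Fin N)) (g : EuclideanSpace ℂ (Fin N)) :
    ‖∑ i, (w i : ℂ) * g i‖ ≤ ‖w‖ * ‖g‖ := by
  have h := norm_inner_le_norm (𝕜 := ℂ) (WithLp.toLp 2 fun i => (w i : ℂ)) g
  have hn : ‖(WithLp.toLp 2 fun i => (w i : ℂ) : EuclideanSpace ℂ (Fin N))‖ = ‖w‖ := by
    simp [EuclideanSpace.norm_eq]
  rw [hn] at h
  refine le_trans (le_of_eq ?_) h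
  simp [PiLp.inner_apply, mul_comm]

theorem enorm_fderiv_mollify_le (hu : LocallyIntegrable u) (hG : LocallyIntegrable G)
    (hw : IsWeakGradient (ball x₀ R) u G) {x : EuclideanSpace ℝ (Fin N)}
    (hx : closedBall x φ.rOut ⊆ ball x₀ R) :
    ‖fderiv ℝ (mollify φ u) x‖ₑ ≤ ∫⁻ y, ‖φ.normed volume y‖ₑ * ‖G (x - y)‖ₑ := by
  rw [← lintegral_sub_left_eq_self _ x]
  simp only [sub_sub_cancel]
  refine ContinuousLinearMap.opENorm_le_bound _ fun w => ?_
  rw [fderiv_mollify_eq hu hG hw hx]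
  refine (enorm_integral_le_lintegral_enorm _).trans ?_
  rw [mul_comm, ← lintegral_const_mul' _ _ enorm_ne_top]
  refine lintegral_mono fun y => ?_
  rw [enorm_smul, mul_left_comm]
  gcongr
  rw [← ofReal_norm, ← ofReal_norm, ← ofReal_norm, ← ENNReal.ofReal_mul (norm_nonneg _)]
  exact ENNReal.ofReal_le_ofReal (norm_sum_ofReal_mul_le w _)

/-- The bump is a probability density, so Jensen moves the square inside the average; each translate
of the small ball by a point of the bump's support still lies in the large one. -/
theorem setLIntegral_fderiv_mollify_sq_le (hu : LocallyIntegrable u) (hG : LocallyIntegrable G)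
    (hGm : Measurable G) (hw : IsWeakGradient (ball x₀ R) u G) (hr : r + φ.rOut < R) :
    ∫⁻ x in ball x₀ r, ‖fderiv ℝ (mollify φ u) x‖ₑ ^ 2 ≤ ∫⁻ x in ball x₀ R, ‖G x‖ₑ ^ 2 := by
  have hφm : Measurable fun y => ‖φ.normed volume y‖ₑ := φ.continuous_normed.enorm.measurable
  have hφ1 : ∫⁻ y, ‖φ.normed volume y‖ₑ = 1 := by
    have h := ofReal_integral_eq_lintegral_ofReal (φ.integrable_normed (μ := volume))
      (.of_forall φ.nonneg_normed)
    rw [φ.integral_normed, ENNReal.ofReal_one] at h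
    rw [h]
    exact lintegral_congr fun y => Real.enorm_of_nonneg (φ.nonneg_normed y)
  have hprob : IsProbabilityMeasure ((volume : Measure (EuclideanSpace ℝ (Fin N))).withDensity
      fun y => ‖φ.normed volume y‖ₑ) := ⟨by simp [hφ1]⟩
  have hpt : ∀ x ∈ ball x₀ r, ‖fderiv ℝ (mollify φ u) x‖ₑ ^ 2 ≤
      ∫⁻ y, ‖φ.normed volume y‖ₑ * ‖G (x - y)‖ₑ ^ 2 := by
    intro x hx
    have hsub : closedBall x φ.rOut ⊆ ball x₀ R :=
      closedBall_subset_ball' (by rw [mem_ball] at hx; linarith)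
    have h1 := enorm_fderiv_mollify_le hu hG hw hsub
    have hm : Measurable fun y => ‖G (x - y)‖ₑ :=
      (hGm.comp (measurable_const.sub measurable_id)).enorm
    have h2 := lintegral_sq_le_lintegral_sq (μ := volume.withDensity
      fun y => ‖φ.normed volume y‖ₑ) hm.aemeasurable
    rw [lintegral_withDensity_eq_lintegral_mul _ hφm hm,
      lintegral_withDensity_eq_lintegral_mul _ hφm (hm.pow_const 2)] at h2
    exact (pow_le_pow_left' h1 2).trans h2
  calc _ ≤ ∫⁻ x in ball x₀ r, ∫⁻ y, ‖φ.normed volume y‖ₑ * ‖G (x - y)‖ₑ ^ 2 :=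
        setLIntegral_mono' measurableSet_ball hpt
    _ = ∫⁻ y, ∫⁻ x in ball x₀ r, ‖φ.normed volume y‖ₑ * ‖G (x - y)‖ₑ ^ 2 := by
        refine lintegral_lintegral_swap (Measurable.aemeasurable ?_)
        exact (hφm.comp measurable_snd).mul
          ((hGm.comp (measurable_fst.sub measurable_snd)).enorm.pow_const 2)
    _ ≤ ∫⁻ y, ‖φ.normed volume y‖ₑ * ∫⁻ x in ball x₀ R, ‖G x‖ₑ ^ 2 := by
        refine lintegral_mono fun y => ?_
        dsimp only
        rw [lintegral_const_mul' _ _ enorm_ne_top]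
        by_cases hy : φ.normed volume y = 0
        · simp [hy]
        have hyb : y ∈ ball 0 φ.rOut := by
          rw [← φ.support_normed_eq (μ := volume)]; exact hy
        refine mul_le_mul_right ?_ ‖φ.normed volume y‖ₑ
        have h := setLIntegral_comp_smul_add_le volume (fun x => ‖G x‖ₑ ^ 2) one_pos (-y)
          (measurableSet_ball (x := x₀) (ε := r)) (measurableSet_ball (x := x₀) (ε := R))
          (fun x hx => by
            rw [mem_ball, dist_eq_norm] at hx ⊢
            rw [mem_ball_zero_iff] at hyb
            calc ‖(1 : ℝ) • x + -y - x₀‖ = ‖(x - x₀) - y‖ := by congr 1; module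
              _ ≤ ‖x - x₀‖ + ‖y‖ := norm_sub_le _ _
              _ < R := by linarith)
        simpa [sub_eq_add_neg] using h
    _ = _ := by rw [lintegral_mul_const _ hφm, hφ1, one_mul]

end Mollify

/-! ### Contraction toward a point: weakly differentiable functions -/

section Displacement

variable {N : ℕ} {u : EuclideanSpace ℝ (Fin N) → ℂ}
  {G : EuclideanSpace ℝ (Fin N) → EuclideanSpace ℂ (Fin N)}
  {x₀ z : EuclideanSpace ℝ (Fin N)} {r R δ : ℝ}

/-- Apply the smooth estimate to mollifications of radius less than R - r and pass to the limit with
Fatou's lemma. -/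
theorem setLIntegral_sub_sq_le_of_isWeakGradient (hu : LocallyIntegrable u)
    (hG : LocallyIntegrable G) (hGm : Measurable G) (hw : IsWeakGradient (ball x₀ R) u G)
    (hrR : r < R) (hz : z ∈ ball x₀ r) (h0 : 0 ≤ δ) (h1 : δ ≤ 1 / 2) :
    ∫⁻ x in ball x₀ r, ‖u x - u ((1 - δ) • x + δ • z)‖ₑ ^ 2 ≤
      ENNReal.ofReal (2 * r * δ) ^ 2 * 2 ^ N * ∫⁻ x in ball x₀ R, ‖G x‖ₑ ^ 2 := by
  set φ : ℕ → ContDiffBump (0 : EuclideanSpace ℝ (Fin N)) := fun k =>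
    ⟨(R - r) / (k + 2) / 2, (R - r) / (k + 2), by
      have := sub_pos.2 hrR; positivity, half_lt_self (by have := sub_pos.2 hrR; positivity)⟩
    with hφ
  have hout : ∀ k, (φ k).rOut = (R - r) / (k + 2) := fun k => rfl
  have hlim : Tendsto (fun k => (φ k).rOut) atTop (𝓝 0) := by
    simp only [hout]
    exact tendsto_const_nhds.div_atTop
      (tendsto_atTop_add_const_right _ _ tendsto_natCast_atTop_atTop)
  have hae : ∀ᵐ x, Tendsto (fun k => mollify (φ k) u x) atTop (𝓝 (u x)) :=
    ContDiffBump.ae_convolution_tendsto_right_of_locallyIntegrable hlim (K := 2)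
      (.of_forall fun k => by simp only [hφ]; linarith) hu
  -- Null sets pull back to null sets under the contraction, so convergence a.e. also holds at the
  -- displaced point.
  have hae' : ∀ᵐ x, Tendsto (fun k => mollify (φ k) u ((1 - δ) • x + δ • z)) atTop
      (𝓝 (u ((1 - δ) • x + δ • z))) :=
    (quasiMeasurePreserving_smul_add volume (by linarith : 0 < 1 - δ) (δ • z)).ae hae
  calc ∫⁻ x in ball x₀ r, ‖u x - u ((1 - δ) • x + δ • z)‖ₑ ^ 2
      = ∫⁻ x in ball x₀ r, liminf (fun k =>
          ‖mollify (φ k) u x - mollify (φ k) u ((1 - δ) • x + δ • z)‖ₑ ^ 2) atTop := by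
        refine lintegral_congr_ae (ae_restrict_of_ae ?_)
        filter_upwards [hae, hae'] with x hx hx'
        have h := ((ENNReal.continuous_pow 2).tendsto _).comp
          ((continuous_enorm.tendsto _).comp (hx.sub hx'))
        exact h.liminf_eq.symm
    _ ≤ liminf (fun k => ∫⁻ x in ball x₀ r,
          ‖mollify (φ k) u x - mollify (φ k) u ((1 - δ) • x + δ • z)‖ₑ ^ 2) atTop := by
        refine lintegral_liminf_le fun k => ?_
        have := (contDiff_mollify (φ := φ k) hu).continuous
        have h2 : Continuous fun x =>
          mollify (φ k) u x - mollify (φ k) u ((1 - δ) • x + δ • z) := by fun_prop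
        exact h2.enorm.measurable.pow_const 2
    _ ≤ _ := by
        refine liminf_le_of_frequently_le' (Frequently.of_forall fun k => ?_)
        refine (setLIntegral_sub_sq_le_of_contDiff volume (contDiff_mollify hu) hz h0 h1).trans ?_
        rw [finrank_euclideanSpace_fin]
        refine mul_le_mul_right ?_ (ENNReal.ofReal (2 * r * δ) ^ 2 * 2 ^ N)
        refine setLIntegral_fderiv_mollify_sq_le hu hG hGm hw ?_
        rw [hout]
        have : (R - r) / (k + 2) < R - r :=
          div_lt_self (sub_pos.2 hrR) (by have : (0 : ℝ) ≤ k := k.cast_nonneg; linarith)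
        linarith

end Displacement

/-! ### Interpolation between the gradient and a lower power -/

theorem ENNReal.add_sq_le (a b : ℝ≥0∞) : (a + b) ^ 2 ≤ 2 * a ^ 2 + 2 * b ^ 2 := by
  have h := ENNReal.rpow_add_le_mul_rpow_add_rpow a b one_le_two
  norm_num at h
  rwa [mul_add] at h

section Interpolation

variable {N : ℕ} {u : EuclideanSpace ℝ (Fin N) → ℂ}
  {G : EuclideanSpace ℝ (Fin N) → EuclideanSpace ℂ (Fin N)}
  {x₀ : EuclideanSpace ℝ (Fin N)} {r R ρ₀ δ q : ℝ}

/-- Average the displacement over z uniform in the ball: |u| ≤ a + w, where a averages |u(x) - u(T x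
z)| and w averages |u(T x z)|. The displacement estimate controls a in L². For w, interpolate L²
between L^∞ and L^q. -/
theorem setLIntegral_sq_le_of_isWeakGradient (hu : LocallyIntegrable u) (hum : Measurable u)
    (hG : LocallyIntegrable G) (hGm : Measurable G) (hw : IsWeakGradient (ball x₀ R) u G)
    (hr : 0 < r) (hrR : r < R) (h0 : 0 < δ) (h1 : δ ≤ 1 / 2) (hq1 : 1 ≤ q) (hq2 : q ≤ 2) :
    ∫⁻ x in ball x₀ r, ‖u x‖ₑ ^ 2 ≤
      2 * (ENNReal.ofReal (2 * r * δ) ^ 2 * 2 ^ N * ∫⁻ x in ball x₀ R, ‖G x‖ₑ ^ 2) +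
      2 * (((volume (ball x₀ r))⁻¹ * ENNReal.ofReal ((δ ^ N)⁻¹) *
        ∫⁻ x in ball x₀ r, ‖u x‖ₑ ^ q) ^ ((2 - q) / q) *
        (2 ^ N * ∫⁻ x in ball x₀ r, ‖u x‖ₑ ^ q)) := by
  set b := ∫⁻ x in ball x₀ r, ‖u x‖ₑ ^ q with hb
  set E := ∫⁻ x in ball x₀ R, ‖G x‖ₑ ^ 2 with hE
  set V := volume (ball x₀ r) with hV
  have hV0 : V ≠ 0 := (measure_ball_pos _ _ hr).ne'
  have hVt : V ≠ ⊤ := measure_ball_lt_top.ne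
  set ν : Measure (EuclideanSpace ℝ (Fin N)) := V⁻¹ • volume.restrict (ball x₀ r) with hν
  have hνp : IsProbabilityMeasure ν := ⟨by
    simp only [hν, Measure.smul_apply, Measure.restrict_apply_univ, smul_eq_mul]
    exact ENNReal.inv_mul_cancel hV0 hVt⟩
  have hνae : ∀ᵐ z ∂ν, z ∈ ball x₀ r :=
    Measure.ae_smul_measure (ae_restrict_mem measurableSet_ball) _
  set T : EuclideanSpace ℝ (Fin N) → EuclideanSpace ℝ (Fin N) → EuclideanSpace ℝ (Fin N) :=
    fun x z => (1 - δ) • x + δ • z with hT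
  have hTm : Measurable fun p : EuclideanSpace ℝ (Fin N) × EuclideanSpace ℝ (Fin N) =>
      T p.1 p.2 := by
    have : Continuous fun p : EuclideanSpace ℝ (Fin N) × EuclideanSpace ℝ (Fin N) =>
      T p.1 p.2 := by fun_prop
    exact this.measurable
  have hd : Measurable fun p : EuclideanSpace ℝ (Fin N) × EuclideanSpace ℝ (Fin N) =>
      ‖u p.1 - u (T p.1 p.2)‖ₑ := ((hum.comp measurable_fst).sub (hum.comp hTm)).enorm
  have hc : Measurable fun p : EuclideanSpace ℝ (Fin N) × EuclideanSpace ℝ (Fin N) =>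
      ‖u (T p.1 p.2)‖ₑ := (hum.comp hTm).enorm
  have hdx : ∀ x, Measurable fun z => ‖u x - u (T x z)‖ₑ := fun x =>
    (measurable_const.sub (hum.comp (by fun_prop))).enorm
  have hcx : ∀ x, Measurable fun z => ‖u (T x z)‖ₑ := fun x => (hum.comp (by fun_prop)).enorm
  set a : EuclideanSpace ℝ (Fin N) → ℝ≥0∞ := fun x => ∫⁻ z, ‖u x - u (T x z)‖ₑ ∂ν with ha
  set w : EuclideanSpace ℝ (Fin N) → ℝ≥0∞ := fun x => ∫⁻ z, ‖u (T x z)‖ₑ ∂ν with hw'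
  have ham : Measurable a := hd.lintegral_prod_right'
  have hwm : Measurable w := hc.lintegral_prod_right'
  have hsplit : ∀ x, ‖u x‖ₑ ^ 2 ≤ 2 * a x ^ 2 + 2 * w x ^ 2 := by
    intro x
    refine le_trans ?_ (ENNReal.add_sq_le _ _)
    gcongr
    calc ‖u x‖ₑ = ∫⁻ z, ‖u x‖ₑ ∂ν := by simp
      _ ≤ ∫⁻ z, (‖u x - u (T x z)‖ₑ + ‖u (T x z)‖ₑ) ∂ν := by
          refine lintegral_mono fun z => ?_
          calc ‖u x‖ₑ = ‖(u x - u (T x z)) + u (T x z)‖ₑ := by rw [sub_add_cancel]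
            _ ≤ _ := enorm_add_le _ _
      _ = a x + w x := lintegral_add_right _ (hcx x)
  have hA : ∫⁻ x in ball x₀ r, a x ^ 2 ≤ ENNReal.ofReal (2 * r * δ) ^ 2 * 2 ^ N * E := by
    calc ∫⁻ x in ball x₀ r, a x ^ 2
        ≤ ∫⁻ x in ball x₀ r, ∫⁻ z, ‖u x - u (T x z)‖ₑ ^ 2 ∂ν ∂volume :=
          lintegral_mono fun x =>
            lintegral_sq_le_lintegral_sq (f := fun z => ‖u x - u (T x z)‖ₑ) (hdx x).aemeasurable
      _ = ∫⁻ z, ∫⁻ x in ball x₀ r, ‖u x - u (T x z)‖ₑ ^ 2 ∂volume ∂ν :=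
          lintegral_lintegral_swap (hd.pow_const 2).aemeasurable
      _ ≤ ∫⁻ z, ENNReal.ofReal (2 * r * δ) ^ 2 * 2 ^ N * E ∂ν := by
          refine lintegral_mono_ae ?_
          filter_upwards [hνae] with z hz
          exact setLIntegral_sub_sq_le_of_isWeakGradient hu hG hGm hw hrR hz h0.le h1
      _ = _ := by simp
  have hwq : ∀ x, w x ^ q ≤ ∫⁻ z, ‖u (T x z)‖ₑ ^ q ∂ν := fun x =>
    lintegral_rpow_le_lintegral_rpow (f := fun z => ‖u (T x z)‖ₑ) (hcx x).aemeasurable hq1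
  -- For fixed x, change variables in z: the ratio is δ, whence the factor δ^(-N).
  have hsup : ∀ x ∈ ball x₀ r, w x ^ q ≤ V⁻¹ * ENNReal.ofReal ((δ ^ N)⁻¹) * b := by
    intro x hx
    refine (hwq x).trans ?_
    rw [hν, lintegral_smul_measure, smul_eq_mul, mul_assoc]
    refine mul_le_mul_right ?_ V⁻¹
    have h := setLIntegral_comp_smul_add_le volume (fun y => ‖u y‖ₑ ^ q) h0 ((1 - δ) • x)
      (measurableSet_ball (x := x₀) (ε := r)) (measurableSet_ball (x := x₀) (ε := r))
      (fun z hz => by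
        rw [add_comm]; exact smul_add_mem_ball hx hz h0.le (by linarith))
    rw [finrank_euclideanSpace_fin] at h
    simpa only [hT, add_comm] using h
  -- For fixed z, change variables in x instead: the ratio 1 - δ ≥ 1/2 costs only 2^N, uniformly in
  -- δ.
  have hint : ∫⁻ x in ball x₀ r, w x ^ q ≤ 2 ^ N * b := by
    calc ∫⁻ x in ball x₀ r, w x ^ q
        ≤ ∫⁻ x in ball x₀ r, ∫⁻ z, ‖u (T x z)‖ₑ ^ q ∂ν ∂volume := lintegral_mono hwq
      _ = ∫⁻ z, ∫⁻ x in ball x₀ r, ‖u (T x z)‖ₑ ^ q ∂volume ∂ν :=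
          lintegral_lintegral_swap (hc.pow_const q).aemeasurable
      _ ≤ ∫⁻ z, 2 ^ N * b ∂ν := by
          refine lintegral_mono_ae ?_
          filter_upwards [hνae] with z hz
          refine (setLIntegral_comp_smul_add_le volume (fun y => ‖u y‖ₑ ^ q)
            (by linarith : 0 < 1 - δ) (δ • z) measurableSet_ball measurableSet_ball
            (fun x hx => smul_add_mem_ball hx hz h0.le (by linarith))).trans ?_
          refine mul_le_mul_left ?_ b
          rw [finrank_euclideanSpace_fin]
          exact ofReal_inv_pow_le (by linarith) N
      _ = _ := by simp
  have hW : ∫⁻ x in ball x₀ r, w x ^ 2 ≤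
      (V⁻¹ * ENNReal.ofReal ((δ ^ N)⁻¹) * b) ^ ((2 - q) / q) * (2 ^ N * b) := by
    calc ∫⁻ x in ball x₀ r, w x ^ 2
        ≤ ∫⁻ x in ball x₀ r,
            (V⁻¹ * ENNReal.ofReal ((δ ^ N)⁻¹) * b) ^ ((2 - q) / q) * w x ^ q := by
          refine setLIntegral_mono' measurableSet_ball fun x hx => ?_
          have h2 : w x ^ 2 = (w x ^ q) ^ ((2 - q) / q) * w x ^ q := by
            rw [← ENNReal.rpow_mul, mul_div_cancel₀ _ (by linarith : q ≠ 0),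
              ← ENNReal.rpow_add_of_nonneg _ _ (by linarith) (by linarith), sub_add_cancel]
            simp
          rw [h2]
          exact mul_le_mul_left
            (ENNReal.rpow_le_rpow (hsup x hx) (div_nonneg (by linarith) (by linarith))) _
      _ = (V⁻¹ * ENNReal.ofReal ((δ ^ N)⁻¹) * b) ^ ((2 - q) / q) * ∫⁻ x in ball x₀ r, w x ^ q :=
          lintegral_const_mul _ (hwm.pow_const q)
      _ ≤ _ := by gcongr
  calc ∫⁻ x in ball x₀ r, ‖u x‖ₑ ^ 2
      ≤ ∫⁻ x in ball x₀ r, (2 * a x ^ 2 + 2 * w x ^ 2) := lintegral_mono hsplit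
    _ = (2 * ∫⁻ x in ball x₀ r, a x ^ 2) + 2 * ∫⁻ x in ball x₀ r, w x ^ 2 := by
        rw [lintegral_add_right _ ((hwm.pow_const 2).const_mul 2),
          lintegral_const_mul _ (ham.pow_const 2), lintegral_const_mul _ (hwm.pow_const 2)]
    _ ≤ _ := add_le_add (mul_le_mul_right hA 2) (mul_le_mul_right hW 2)

/-- Contraction by one half toward the centre compares u on the ball with u on the concentric half
ball. As the latter stays away from the boundary, this yields square integrability up to the
boundary. -/
theorem setLIntegral_sq_le_half_of_isWeakGradient (hu : LocallyIntegrable u) (hum : Measurable u)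
    (hG : LocallyIntegrable G) (hGm : Measurable G) (hw : IsWeakGradient (ball x₀ R) u G)
    (hr : 0 < r) (hrR : r < R) :
    ∫⁻ x in ball x₀ r, ‖u x‖ₑ ^ 2 ≤
      2 * (ENNReal.ofReal r ^ 2 * 2 ^ N * ∫⁻ x in ball x₀ R, ‖G x‖ₑ ^ 2) +
      2 * (2 ^ N * ∫⁻ x in ball x₀ (r / 2), ‖u x‖ₑ ^ 2) := by
  have hA := setLIntegral_sub_sq_le_of_isWeakGradient hu hG hGm hw hrR (mem_ball_self hr)
    (by norm_num : (0 : ℝ) ≤ 1 / 2) le_rfl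
  have hB := setLIntegral_comp_smul_add_le volume (fun y => ‖u y‖ₑ ^ 2)
    (by norm_num : (0 : ℝ) < 1 / 2) ((1 / 2 : ℝ) • x₀)
    (measurableSet_ball (x := x₀) (ε := r)) (measurableSet_ball (x := x₀) (ε := r / 2))
    (fun x hx => by
      rw [mem_ball, dist_eq_norm] at hx ⊢
      have : (1 / 2 : ℝ) • x + (1 / 2 : ℝ) • x₀ - x₀ = (1 / 2 : ℝ) • (x - x₀) := by module
      rw [this, norm_smul, Real.norm_of_nonneg (by norm_num)]
      linarith)
  have h12 : (1 : ℝ) - 1 / 2 = 1 / 2 := by norm_num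
  rw [h12, show 2 * r * (1 / 2) = r by ring] at hA
  calc ∫⁻ x in ball x₀ r, ‖u x‖ₑ ^ 2
      ≤ ∫⁻ x in ball x₀ r, (2 * ‖u x - u ((1 / 2 : ℝ) • x + (1 / 2 : ℝ) • x₀)‖ₑ ^ 2 +
          2 * ‖u ((1 / 2 : ℝ) • x + (1 / 2 : ℝ) • x₀)‖ₑ ^ 2) := by
        refine lintegral_mono fun x => le_trans ?_ (ENNReal.add_sq_le _ _)
        gcongr
        calc ‖u x‖ₑ = ‖(u x - u ((1 / 2 : ℝ) • x + (1 / 2 : ℝ) • x₀)) +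
              u ((1 / 2 : ℝ) • x + (1 / 2 : ℝ) • x₀)‖ₑ := by rw [sub_add_cancel]
          _ ≤ _ := enorm_add_le _ _
    _ = (2 * ∫⁻ x in ball x₀ r, ‖u x - u ((1 / 2 : ℝ) • x + (1 / 2 : ℝ) • x₀)‖ₑ ^ 2) +
          2 * ∫⁻ x in ball x₀ r, ‖u ((1 / 2 : ℝ) • x + (1 / 2 : ℝ) • x₀)‖ₑ ^ 2 := by
        have hT : Measurable fun x : EuclideanSpace ℝ (Fin N) =>
          (1 / 2 : ℝ) • x + (1 / 2 : ℝ) • x₀ := by fun_prop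
        have hm : Measurable fun x => ‖u ((1 / 2 : ℝ) • x + (1 / 2 : ℝ) • x₀)‖ₑ ^ 2 :=
          (hum.comp hT).enorm.pow_const 2
        have hm' : Measurable fun x => ‖u x - u ((1 / 2 : ℝ) • x + (1 / 2 : ℝ) • x₀)‖ₑ ^ 2 :=
          (hum.sub (hum.comp hT)).enorm.pow_const 2
        rw [lintegral_add_right _ (hm.const_mul 2), lintegral_const_mul _ hm,
          lintegral_const_mul _ hm']
    _ ≤ _ := by
        refine add_le_add (mul_le_mul_right hA 2) (mul_le_mul_right (hB.trans ?_) 2)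
        refine mul_le_mul_left ?_ _
        rw [finrank_euclideanSpace_fin]
        exact ofReal_inv_pow_le le_rfl N

theorem IsWeakGradient.mono {Ω Ω' : Set (EuclideanSpace ℝ (Fin N))} (h : IsWeakGradient Ω u G)
    (hΩ : MeasurableSet Ω) (hsub : Ω' ⊆ Ω) : IsWeakGradient Ω' u G := by
  intro φ hφ hφc hφs i
  have key := h φ hφ hφc (hφs.trans hsub) i
  rwa [setIntegral_eq_of_subset_of_forall_sdiff_eq_zero hΩ hsub,
    setIntegral_eq_of_subset_of_forall_sdiff_eq_zero hΩ hsub] at key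
  · intro x hx
    have : φ x = 0 := image_eq_zero_of_notMem_tsupport fun h' => hx.2 (hφs h')
    simp [this]
  · intro x hx
    have : fderiv ℝ φ x = 0 :=
      image_eq_zero_of_notMem_tsupport fun h' => hx.2 (hφs (tsupport_fderiv_subset ℝ h'))
    simp [this]

theorem IsWeakGradient.congr_ae {Ω : Set (EuclideanSpace ℝ (Fin N))}
    {u' : EuclideanSpace ℝ (Fin N) → ℂ}
    {G' : EuclideanSpace ℝ (Fin N) → EuclideanSpace ℂ (Fin N)} (h : IsWeakGradient Ω u G)
    (hu : u =ᵐ[volume.restrict Ω] u') (hG : G =ᵐ[volume.restrict Ω] G') :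
    IsWeakGradient Ω u' G' := by
  intro φ hφ hφc hφs i
  refine (integral_congr_ae ?_).trans
    ((h φ hφ hφc hφs i).trans (congrArg Neg.neg (integral_congr_ae ?_)))
  · filter_upwards [hu] with x hx
    rw [hx]
  · filter_upwards [hG] with x hx
    rw [hx]

theorem IsH1Loc.mono {Ω Ω' : Set (EuclideanSpace ℝ (Fin N))} (h : IsH1Loc Ω u G)
    (hΩ : MeasurableSet Ω) (hsub : Ω' ⊆ Ω) : IsH1Loc Ω' u G :=
  ⟨fun K hK hKs => h.memL2Loc K hK (hKs.trans hsub),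
    fun K hK hKs => h.grad_memL2Loc K hK (hKs.trans hsub), h.isWeakGradient.mono hΩ hsub⟩

/-- A function in `H¹_loc` of a ball agrees, on any smaller ball, with a measurable and locally
integrable function on the whole space that has the same weak gradient there. -/
theorem IsH1Loc.exists_measurable_rep (h : IsH1Loc (ball x₀ R) u G) (hrR : r < R) :
    ∃ (u' : EuclideanSpace ℝ (Fin N) → ℂ)
      (G' : EuclideanSpace ℝ (Fin N) → EuclideanSpace ℂ (Fin N)),
      LocallyIntegrable u' ∧ Measurable u' ∧ LocallyIntegrable G' ∧ Measurable G' ∧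
      IsWeakGradient (ball x₀ r) u' G' ∧ u =ᵐ[volume.restrict (ball x₀ r)] u' ∧
      G =ᵐ[volume.restrict (ball x₀ r)] G' := by
  have hK : IsCompact (closedBall x₀ r) := isCompact_closedBall _ _
  have hKm : MeasurableSet (closedBall x₀ r) := measurableSet_closedBall
  have hKs : closedBall x₀ r ⊆ ball x₀ R := closedBall_subset_ball hrR
  have hbK : ball x₀ r ⊆ closedBall x₀ r := ball_subset_closedBall
  have hu := h.memL2Loc _ hK hKs
  have hG := h.grad_memL2Loc _ hK hKs
  set u' := (closedBall x₀ r).indicator (hu.1.mk u) with hu'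
  set G' := (closedBall x₀ r).indicator (hG.1.mk G) with hG'
  have hLu : MemLp u' 2 volume :=
    (memLp_indicator_iff_restrict hKm).2 ((memLp_congr_ae hu.1.ae_eq_mk).1 hu)
  have hLG : MemLp G' 2 volume :=
    (memLp_indicator_iff_restrict hKm).2 ((memLp_congr_ae hG.1.ae_eq_mk).1 hG)
  have heu : u =ᵐ[volume.restrict (ball x₀ r)] u' := by
    filter_upwards [ae_restrict_of_ae_restrict_of_subset hbK hu.1.ae_eq_mk,
      ae_restrict_mem measurableSet_ball] with x hx hxb
    rw [hu', indicator_of_mem (hbK hxb), hx]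
  have heG : G =ᵐ[volume.restrict (ball x₀ r)] G' := by
    filter_upwards [ae_restrict_of_ae_restrict_of_subset hbK hG.1.ae_eq_mk,
      ae_restrict_mem measurableSet_ball] with x hx hxb
    rw [hG', indicator_of_mem (hbK hxb), hx]
  refine ⟨u', G', hLu.locallyIntegrable (by norm_num),
    (hu.1.stronglyMeasurable_mk.measurable.indicator hKm), hLG.locallyIntegrable (by norm_num),
    (hG.1.stronglyMeasurable_mk.measurable.indicator hKm),
    (h.isWeakGradient.mono measurableSet_ball (ball_subset_ball hrR.le)).congr_ae heu heG,
    heu, heG⟩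

/-- An additive Gagliardo-Nirenberg inequality on a ball. -/
theorem IsH1Loc.setLIntegral_sq_le (h : IsH1Loc (ball x₀ R) u G) (hρ₀ : 0 < ρ₀) (hR : ρ₀ < R)
    (h0 : 0 < δ) (h1 : δ ≤ 1 / 2) (hq1 : 1 ≤ q) (hq2 : q ≤ 2) :
    ∫⁻ x in ball x₀ R, ‖u x‖ₑ ^ 2 ≤
      2 * (ENNReal.ofReal (2 * R * δ) ^ 2 * 2 ^ N * ∫⁻ x in ball x₀ R, ‖G x‖ₑ ^ 2) +
      2 * (((volume (ball x₀ ρ₀))⁻¹ * ENNReal.ofReal ((δ ^ N)⁻¹) *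
        ∫⁻ x in ball x₀ R, ‖u x‖ₑ ^ q) ^ ((2 - q) / q) *
        (2 ^ N * ∫⁻ x in ball x₀ R, ‖u x‖ₑ ^ q)) := by
  have hqq : 0 ≤ (2 - q) / q := div_nonneg (by linarith) (by linarith)
  refine setLIntegral_ball_le_of_forall_lt fun s hs => ?_
  obtain ⟨r, hr1, hr2⟩ := exists_between (max_lt hs hR)
  obtain ⟨R', hR1, hR2⟩ := exists_between hr2
  have hsr : s ≤ r := (le_max_left _ _).trans hr1.le
  have hρr : ρ₀ ≤ r := (le_max_right _ _).trans hr1.le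
  have hr0 : 0 < r := hρ₀.trans_le hρr
  obtain ⟨u', G', hLu, hum, hLG, hGm, hw, heu, heG⟩ := h.exists_measurable_rep hR2
  have heu' : u =ᵐ[volume.restrict (ball x₀ r)] u' :=
    ae_restrict_of_ae_restrict_of_subset (ball_subset_ball hR1.le) heu
  have key := setLIntegral_sq_le_of_isWeakGradient hLu hum hLG hGm hw hr0 hR1 h0 h1 hq1 hq2
  have e1 : ∫⁻ x in ball x₀ r, ‖u x‖ₑ ^ 2 = ∫⁻ x in ball x₀ r, ‖u' x‖ₑ ^ 2 :=
    lintegral_congr_ae (heu'.fun_comp fun y => ‖y‖ₑ ^ 2)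
  have e2 : ∫⁻ x in ball x₀ r, ‖u x‖ₑ ^ q = ∫⁻ x in ball x₀ r, ‖u' x‖ₑ ^ q :=
    lintegral_congr_ae (heu'.fun_comp fun y => ‖y‖ₑ ^ q)
  have e3 : ∫⁻ x in ball x₀ R', ‖G x‖ₑ ^ 2 = ∫⁻ x in ball x₀ R', ‖G' x‖ₑ ^ 2 :=
    lintegral_congr_ae (heG.fun_comp fun y => ‖y‖ₑ ^ 2)
  rw [← e1, ← e2, ← e3] at key
  refine (lintegral_mono_set (ball_subset_ball hsr)).trans (key.trans ?_)
  -- The volume of the ball of radius ρ₀ replaces that of radius r ≥ ρ₀, which makes the constant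
  -- uniform in the radius.
  gcongr

/-- A function in `H¹_loc` of a ball whose gradient is square integrable is square integrable. -/
theorem IsH1Loc.setLIntegral_sq_lt_top (h : IsH1Loc (ball x₀ R) u G) (hR : 0 < R)
    (hG : ∫⁻ x in ball x₀ R, ‖G x‖ₑ ^ 2 < ⊤) : ∫⁻ x in ball x₀ R, ‖u x‖ₑ ^ 2 < ⊤ := by
  have hc : ∫⁻ x in ball x₀ (R / 2), ‖u x‖ₑ ^ 2 < ⊤ := by
    have h2 := h.memL2Loc (closedBall x₀ (R / 2)) (isCompact_closedBall _ _)
      (closedBall_subset_ball (by linarith))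
    have h3 := lintegral_rpow_enorm_lt_top_of_eLpNorm_lt_top two_ne_zero ENNReal.ofNat_ne_top h2.2
    refine (lintegral_mono_set ball_subset_closedBall).trans_lt ?_
    simpa using h3
  refine lt_of_le_of_lt (setLIntegral_ball_le_of_forall_lt (C := 2 * (ENNReal.ofReal R ^ 2 * 2 ^ N *
    ∫⁻ x in ball x₀ R, ‖G x‖ₑ ^ 2) + 2 * (2 ^ N * ∫⁻ x in ball x₀ (R / 2), ‖u x‖ₑ ^ 2))
    fun s hs => ?_) ?_
  · obtain ⟨r, hr1, hr2⟩ := exists_between (max_lt hs hR)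
    obtain ⟨R', hR1, hR2⟩ := exists_between hr2
    have hsr : s ≤ r := (le_max_left _ _).trans hr1.le
    have hr0 : 0 < r := (le_max_right _ _).trans_lt hr1
    obtain ⟨u', G', hLu, hum, hLG, hGm, hw, heu, heG⟩ := h.exists_measurable_rep hR2
    have heu' : u =ᵐ[volume.restrict (ball x₀ r)] u' :=
      ae_restrict_of_ae_restrict_of_subset (ball_subset_ball hR1.le) heu
    have heu2 : u =ᵐ[volume.restrict (ball x₀ (r / 2))] u' :=
      ae_restrict_of_ae_restrict_of_subset (ball_subset_ball (by linarith)) heu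
    have key := setLIntegral_sq_le_half_of_isWeakGradient hLu hum hLG hGm hw hr0 hR1
    have e1 : ∫⁻ x in ball x₀ r, ‖u x‖ₑ ^ 2 = ∫⁻ x in ball x₀ r, ‖u' x‖ₑ ^ 2 :=
      lintegral_congr_ae (heu'.fun_comp fun y => ‖y‖ₑ ^ 2)
    have e2 : ∫⁻ x in ball x₀ (r / 2), ‖u x‖ₑ ^ 2 = ∫⁻ x in ball x₀ (r / 2), ‖u' x‖ₑ ^ 2 :=
      lintegral_congr_ae (heu2.fun_comp fun y => ‖y‖ₑ ^ 2)
    have e3 : ∫⁻ x in ball x₀ R', ‖G x‖ₑ ^ 2 = ∫⁻ x in ball x₀ R', ‖G' x‖ₑ ^ 2 :=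
      lintegral_congr_ae (heG.fun_comp fun y => ‖y‖ₑ ^ 2)
    rw [← e1, ← e2, ← e3] at key
    refine (lintegral_mono_set (ball_subset_ball hsr)).trans (key.trans ?_)
    gcongr
  · finiteness

end Interpolation

/-! ### Iteration, exponents and thresholds -/

/-- De Giorgi's iteration: a superlinear decay inequality with a source of matching order forces a
sufficiently small monotone quantity to vanish. -/
theorem nonpos_of_superlinear_decay {Q : ℝ → ℝ} {ρ₀ h p K D η : ℝ} (hh : 0 < h) (hp : 0 < p)
    (hη0 : 0 < η) (hη1 : η ≤ 1) (hK : 0 ≤ K) (hQ0 : ∀ r, 0 ≤ Q r)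
    (hmono : ∀ r R, r ≤ R → R ≤ ρ₀ + h → Q r ≤ Q R)
    (hdecay : ∀ r R, ρ₀ ≤ r → r < R → R ≤ ρ₀ + h → Q R ≤ 1 →
      (R - r) * Q r ≤ K * Q R ^ (1 + 1 / p) + D * (R - r) * (R - ρ₀) ^ p)
    (hinit : Q (ρ₀ + h) ≤ η) (hηK : K * η ^ (1 / p) ≤ 2 ^ (-p) * h / 4)
    (hDη : D * h ^ p ≤ η * 2 ^ (-p) / 2) : Q ρ₀ ≤ 0 := by
  set l : ℝ := 2 ^ (-p) with hl
  have hl0 : 0 < l := by positivity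
  have hl1 : l < 1 := Real.rpow_lt_one_of_one_lt_of_neg one_lt_two (by linarith)
  have hlp : l ^ (1 / p) = 1 / 2 := by
    rw [hl, ← Real.rpow_mul (by norm_num), show -p * (1 / p) = -1 by field_simp,
      Real.rpow_neg_one]
    norm_num
  have hhalf : ((1 / 2 : ℝ)) ^ p = l := by
    rw [hl, Real.rpow_neg (by norm_num), one_div, Real.inv_rpow (by norm_num)]
  have key : ∀ k : ℕ, Q (ρ₀ + h * (1 / 2) ^ k) ≤ η * l ^ k := by
    intro k
    induction k with
    | zero => simpa using hinit
    | succ k ih =>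
      set t : ℝ := (1 / 2) ^ k with ht
      have ht0 : 0 < t := by positivity
      have ht1 : t ≤ 1 := pow_le_one₀ (by norm_num) (by norm_num)
      have hlk : 0 < l ^ k := by positivity
      have hlk1 : l ^ k ≤ 1 := pow_le_one₀ hl0.le hl1.le
      have htp : t ^ p = l ^ k := by
        rw [ht, ← Real.rpow_natCast, ← Real.rpow_mul (by norm_num), mul_comm,
          Real.rpow_mul (by norm_num), hhalf, Real.rpow_natCast]
      have hlkp : (l ^ k) ^ (1 / p) = t := by
        rw [← Real.rpow_natCast, ← Real.rpow_mul hl0.le, mul_comm, Real.rpow_mul hl0.le, hlp,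
          Real.rpow_natCast]
      have hd := hdecay (ρ₀ + h * (1 / 2) ^ (k + 1)) (ρ₀ + h * t) (by simp; positivity)
        (by rw [pow_succ]; nlinarith [mul_pos hh ht0]) (by nlinarith)
        (ih.trans (mul_le_one₀ hη1 hlk.le hlk1))
      have e1 : ρ₀ + h * t - (ρ₀ + h * (1 / 2) ^ (k + 1)) = h * t / 2 := by
        rw [pow_succ, ← ht]; ring
      have e2 : (ρ₀ + h * t - ρ₀) ^ p = h ^ p * l ^ k := by
        rw [add_sub_cancel_left, Real.mul_rpow hh.le ht0.le, htp]
      have e3 : Q (ρ₀ + h * t) ^ (1 + 1 / p) ≤ η * l ^ k * (η ^ (1 / p) * t) := by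
        calc Q (ρ₀ + h * t) ^ (1 + 1 / p) ≤ (η * l ^ k) ^ (1 + 1 / p) :=
              Real.rpow_le_rpow (hQ0 _) ih (by positivity)
          _ = _ := by
              rw [Real.rpow_add (by positivity), Real.rpow_one,
                Real.mul_rpow hη0.le hlk.le, hlkp]
      rw [e1, e2] at hd
      -- The nonlinear term and the source each take half of the target (R - r) η l^(k+1), where R -
      -- r = ht/2.
      have b1 : K * Q (ρ₀ + h * t) ^ (1 + 1 / p) ≤ (h * t / 2) * (η * l ^ k * l / 2) := by
        calc _ ≤ K * (η * l ^ k * (η ^ (1 / p) * t)) := by gcongr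
          _ = (K * η ^ (1 / p)) * (η * l ^ k * t) := by ring
          _ ≤ (l * h / 4) * (η * l ^ k * t) := by gcongr
          _ = _ := by ring
      have b2 : D * (h * t / 2) * (h ^ p * l ^ k) ≤ (h * t / 2) * (η * l ^ k * l / 2) := by
        calc _ = (D * h ^ p) * (h * t / 2 * l ^ k) := by ring
          _ ≤ (η * l / 2) * (h * t / 2 * l ^ k) := by gcongr
          _ = _ := by ring
      have hpos : 0 < h * t / 2 := by positivity
      refine le_of_mul_le_mul_left ?_ hpos
      calc _ ≤ _ := hd
        _ ≤ (h * t / 2) * (η * l ^ k * l / 2) + (h * t / 2) * (η * l ^ k * l / 2) :=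
            add_le_add b1 b2
        _ = _ := by rw [pow_succ]; ring
  have hlim : Tendsto (fun k : ℕ => η * l ^ k) atTop (𝓝 0) := by
    simpa using (tendsto_pow_atTop_nhds_zero_of_lt_one hl0.le hl1).const_mul η
  refine ge_of_tendsto' hlim fun k => (hmono _ _ ?_ ?_).trans (key k)
  · simp; positivity
  · have : ((1 : ℝ) / 2) ^ k ≤ 1 := pow_le_one₀ (by norm_num) (by norm_num)
    nlinarith

/-- Choosing the scale in the additive Gagliardo-Nirenberg inequality turns it into a superlinear
bound by the energy. -/
theorem le_energy_rpow_of_forall_scale {n m p L C₁ C₂ E b c Q : ℝ} (hn : 0 ≤ n) (hm0 : 0 < m)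
    (hm1 : m < 1) (hp : p = (2 * (1 + m) + n * (1 - m)) / (1 - m)) (hL : 0 < L) (hC₁ : 0 ≤ C₁)
    (hC₂ : 0 ≤ C₂) (hb : 0 ≤ b) (hEQ : E ≤ Q) (hbQ : L * b ≤ Q) (hQ1 : Q ≤ 1)
    (hscale : ∀ δ : ℝ, 0 < δ → δ ≤ 1 / 2 → c ≤ C₁ * δ ^ 2 * E +
      C₂ * (δ ^ (-n) * b) ^ ((1 - m) / (1 + m)) * b) :
    c ≤ (C₁ / 4 + C₂ * (2 ^ n / L) ^ ((1 - m) / (1 + m)) / L) * Q ^ (1 + 2 / p) := by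
  have hm1' : 0 < 1 - m := by linarith
  set e := (1 - m) / (1 + m) with he
  have he0 : 0 < e := by positivity
  have hp0 : 0 < p := by rw [hp]; positivity
  have hQ0 : 0 ≤ Q := le_trans (by positivity) hbQ
  -- If Q = 0 the scale chosen below would vanish; then b = 0 and E ≤ 0, and any admissible scale
  -- works.
  rcases hQ0.eq_or_lt with hQ | hQ
  · have hb0 : b = 0 := le_antisymm (by nlinarith) hb
    have h := hscale (1 / 2) (by norm_num) le_rfl
    rw [hb0, mul_zero, add_zero] at h
    rw [← hQ, Real.zero_rpow (by positivity), mul_zero]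
    have : C₁ * (1 / 2) ^ 2 * E ≤ 0 :=
      mul_nonpos_of_nonneg_of_nonpos (by positivity) (by rwa [← hQ] at hEQ)
    linarith
  -- With this scale δ² E is of order Q^(1+2/p); the half ensures δ ≤ 1/2 because Q ≤ 1.
  set δ : ℝ := Q ^ (1 / p) / 2 with hδ
  have hδ0 : 0 < δ := by positivity
  have hδ1 : δ ≤ 1 / 2 := by
    have : Q ^ (1 / p) ≤ 1 := Real.rpow_le_one hQ.le hQ1 (by positivity)
    linarith
  have hb' : b ≤ Q / L := by rw [le_div_iff₀ hL]; linarith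
  have hδ2 : δ ^ 2 = Q ^ (2 / p) / 4 := by
    rw [hδ, div_pow, ← Real.rpow_natCast, ← Real.rpow_mul hQ.le]
    norm_num
    congr 1; ring
  have hδn : δ ^ (-n) = 2 ^ n * Q ^ (-(n / p)) := by
    rw [hδ, Real.div_rpow (by positivity) (by norm_num), ← Real.rpow_mul hQ.le,
      Real.rpow_neg (by norm_num : (0 : ℝ) ≤ 2), div_inv_eq_mul, mul_comm]
    congr 2; ring
  -- This identity is what fixes p: the two terms of the interpolation inequality then carry the
  -- same power of Q.
  have hexp : (1 - n / p) * e = 2 / p := by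
    have hpn : p * (1 - m) = 2 * (1 + m) + n * (1 - m) := by rw [hp]; field_simp
    rw [he, one_sub_div hp0.ne', div_mul_div_comm, div_eq_div_iff (by positivity) hp0.ne']
    have : (p - n) * (1 - m) = 2 * (1 + m) := by linarith
    rw [this]; ring
  have hin : δ ^ (-n) * b ≤ 2 ^ n / L * Q ^ (1 - n / p) := by
    calc δ ^ (-n) * b ≤ δ ^ (-n) * (Q / L) := by gcongr
      _ = 2 ^ n / L * (Q ^ (1 : ℝ) * Q ^ (-(n / p))) := by rw [hδn, Real.rpow_one]; ring
      _ = _ := by rw [← Real.rpow_add hQ]; rfl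
  calc c ≤ C₁ * δ ^ 2 * E + C₂ * (δ ^ (-n) * b) ^ e * b := hscale δ hδ0 hδ1
    _ ≤ C₁ * δ ^ 2 * Q + C₂ * (2 ^ n / L * Q ^ (1 - n / p)) ^ e * (Q / L) := by gcongr
    _ = _ := by
        rw [hδ2, Real.mul_rpow (by positivity) (by positivity), ← Real.rpow_mul hQ.le, hexp,
          Real.rpow_add hQ, Real.rpow_one]
        ring

/-- Since (1+m)(1 + (1-m)/(1+m)) = 2, the lower-order term is at most a multiple of s². This bound
serves to start the iteration, where Q ≤ 1 is not yet available. -/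
theorem le_one_add_sq_of_scale_half {n m s C₁ C₂ E b c : ℝ} (hm0 : 0 < m) (hm1 : m < 1)
    (hC₁ : 0 ≤ C₁) (hC₂ : 0 ≤ C₂) (hs : 0 ≤ s) (hE1 : E ≤ 1) (hb : 0 ≤ b) (hbs : b ≤ s ^ (1 + m))
    (h : c ≤ C₁ * (1 / 2) ^ 2 * E + C₂ * ((1 / 2) ^ (-n) * b) ^ ((1 - m) / (1 + m)) * b) :
    c ≤ (C₁ / 4 + C₂ * (2 ^ n) ^ ((1 - m) / (1 + m))) * (1 + s) ^ 2 := by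
  have hm1' : 0 < 1 - m := by linarith
  set e := (1 - m) / (1 + m) with he
  have he0 : 0 < e := by positivity
  have hbe : b ^ e * b ≤ (1 + s) ^ 2 := by
    calc b ^ e * b ≤ (s ^ (1 + m)) ^ e * s ^ (1 + m) := by gcongr
      _ = s ^ 2 := by
          rw [← Real.rpow_mul hs, he, mul_div_cancel₀ _ (by positivity),
            ← Real.rpow_add_of_nonneg hs (by linarith) (by linarith)]
          norm_num
      _ ≤ _ := by gcongr; linarith
  have e4 : ((1 / 2 : ℝ)) ^ (-n) = 2 ^ n := by
    rw [one_div, Real.inv_rpow (by norm_num), Real.rpow_neg (by norm_num), inv_inv]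
  rw [e4, Real.mul_rpow (by positivity) hb] at h
  have h3 : C₂ * ((2 ^ n) ^ e * b ^ e) * b ≤ C₂ * (2 ^ n) ^ e * (1 + s) ^ 2 := by
    calc _ = C₂ * (2 ^ n) ^ e * (b ^ e * b) := by ring
      _ ≤ _ := by gcongr
  have h4 : C₁ * (1 / 2) ^ 2 * E ≤ C₁ / 4 * (1 + s) ^ 2 := by
    have : E ≤ (1 + s) ^ 2 := by nlinarith
    calc _ = C₁ / 4 * E := by ring
      _ ≤ _ := by gcongr
  linarith

/-- The geometric mean of the powers 1 + 2/p and 1 is 1 + 1/p, the exponent of the iteration. -/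
theorem sqrt_mul_le_of_superlinear {C c E Q p : ℝ} (hp : 0 < p) (hC : 0 ≤ C) (hE : 0 ≤ E)
    (hEQ : E ≤ Q) (hc : c ≤ C * Q ^ (1 + 2 / p)) : √(c * E) ≤ √C * Q ^ (1 + 1 / p) := by
  have hQ : 0 ≤ Q := hE.trans hEQ
  calc √(c * E) ≤ √(C * Q ^ (1 + 2 / p) * Q) :=
        Real.sqrt_le_sqrt (mul_le_mul hc hEQ hE (by positivity))
    _ = √(C * (Q ^ (1 + 1 / p)) ^ 2) := by
        congr 1
        rcases hQ.eq_or_lt with h0 | h0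
        · rw [← h0, Real.zero_rpow (by positivity), Real.zero_rpow (by positivity)]; simp
        · rw [mul_assoc]
          congr 1
          nth_rewrite 2 [← Real.rpow_one Q]
          rw [← Real.rpow_add h0, ← Real.rpow_natCast, ← Real.rpow_mul h0.le]
          congr 1
          push_cast
          ring
    _ = √C * Q ^ (1 + 1 / p) := by rw [Real.sqrt_mul hC, Real.sqrt_sq (by positivity)]

/-- The thresholds for the gradient energy and for the source, and the vanishing they force on
energies satisfying an integrated energy inequality. -/
theorem exists_thresholds {n m p ρ₀ ρ₁ L M C₁ C₂ : ℝ} (hn : 0 ≤ n) (hm0 : 0 < m) (hm1 : m < 1)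
    (hp : p = (2 * (1 + m) + n * (1 - m)) / (1 - m)) (hρ : ρ₀ < ρ₁) (hL : 0 < L) (hM : 0 < M)
    (hC₁ : 0 ≤ C₁) (hC₂ : 0 ≤ C₂) :
    ∃ (Es : ℝ → ℝ) (ε : ℝ), (∀ s, 0 ≤ s → 0 < Es s) ∧ 0 < ε ∧ AntitoneOn Es (Ici 0) ∧
      ∀ (E b c Q : ℝ → ℝ) (s : ℝ), 0 ≤ s → (∀ r, 0 ≤ E r) → (∀ r, 0 ≤ b r) →
        (∀ r, 0 ≤ Q r) → (∀ r < ρ₁, E r ≤ Q r) → (∀ r < ρ₁, L * b r ≤ Q r) →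
        (∀ r R, r ≤ R → R < ρ₁ → Q r ≤ Q R) → (∀ R < ρ₁, E R ≤ Es s) →
        (∀ R < ρ₁, b R ≤ s ^ (1 + m)) →
        (∀ R δ : ℝ, ρ₀ < R → R < ρ₁ → 0 < δ → δ ≤ 1 / 2 → c R ≤ C₁ * δ ^ 2 * E R +
          C₂ * (δ ^ (-n) * b R) ^ ((1 - m) / (1 + m)) * b R) →
        (∀ r R, ρ₀ ≤ r → r < R → R < ρ₁ → (R - r) * Q r ≤ M * √(c R * E R) +
          M ^ 2 / (2 * L) * (R - r) * (ε * (R - ρ₀) ^ p)) →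
        Q ρ₀ ≤ 0 := by
  have hm1' : 0 < 1 - m := by linarith
  have hp0 : 0 < p := by rw [hp]; positivity
  obtain ⟨h, hh⟩ : ∃ x : ℝ, x = (ρ₁ - ρ₀) / 2 := ⟨_, rfl⟩
  have hh0 : 0 < h := by rw [hh]; linarith
  set e := (1 - m) / (1 + m) with he
  have he0 : 0 < e := by positivity
  obtain ⟨C₃, hC₃⟩ : ∃ x : ℝ, x = C₁ / 4 + C₂ * (2 ^ n / L) ^ e / L := ⟨_, rfl⟩
  have hC₃0 : 0 ≤ C₃ := by rw [hC₃]; positivity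
  obtain ⟨C₄, hC₄⟩ : ∃ x : ℝ, x = C₁ / 4 + C₂ * (2 ^ n) ^ e := ⟨_, rfl⟩
  have hC₄0 : 0 ≤ C₄ := by rw [hC₄]; positivity
  obtain ⟨K, hK⟩ : ∃ x : ℝ, x = M * √C₃ := ⟨_, rfl⟩
  have hK0 : 0 ≤ K := by rw [hK]; positivity
  set K' : ℝ := M ^ 2 / (2 * L) with hK'
  have hK'0 : 0 < K' := by positivity
  obtain ⟨l, hl⟩ : ∃ x : ℝ, x = 2 ^ (-p) := ⟨_, rfl⟩
  have hl0 : 0 < l := by rw [hl]; positivity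
  have hl1 : l < 1 := hl ▸ Real.rpow_lt_one_of_one_lt_of_neg one_lt_two (by linarith)
  -- The largest η allowed by the nonlinear term, with K + 1 for K so that K = 0 causes no division
  -- by zero.
  obtain ⟨η, hη⟩ : ∃ x : ℝ, x = min 1 ((l * h / (4 * (K + 1))) ^ p) := ⟨_, rfl⟩
  have hη0 : 0 < η := by rw [hη]; positivity
  have hη1 : η ≤ 1 := hη ▸ min_le_left _ _
  have hηp : η ^ (1 / p) ≤ l * h / (4 * (K + 1)) := by
    calc η ^ (1 / p) ≤ ((l * h / (4 * (K + 1))) ^ p) ^ (1 / p) :=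
          Real.rpow_le_rpow hη0.le (hη ▸ min_le_right _ _) (by positivity)
      _ = _ := by
          rw [← Real.rpow_mul (by positivity), mul_one_div_cancel hp0.ne', Real.rpow_one]
  -- Taking 2h here lets one ε serve both the iteration, at distance h, and its initial step, at
  -- distance 3h/2. It does not depend on s.
  obtain ⟨ε, hε⟩ : ∃ x : ℝ, x = η * l / 2 / (K' * (2 * h) ^ p) := ⟨_, rfl⟩
  have hε0 : 0 < ε := by rw [hε]; positivity
  have hεK : K' * ε * (2 * h) ^ p = η * l / 2 := by rw [hε]; field_simp
  -- Chosen so that M √C₄ A ≤ ηh/4, half of what the initial step over a gap h/2 allows.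
  obtain ⟨A, hA⟩ : ∃ x : ℝ, x = η * h / (4 * M * (√C₄ + 1)) := ⟨_, rfl⟩
  have hA0 : 0 < A := by rw [hA]; positivity
  refine ⟨fun s => min 1 ((A / (1 + s)) ^ 2), ε, fun s hs => by positivity, hε0, ?_, ?_⟩
  · intro s hs t ht hst
    rw [mem_Ici] at hs ht
    dsimp only
    gcongr
  intro E b c Q s hs hE hb hQ0 hEQ hbQ hmono hEs hbs hscale hint
  refine nonpos_of_superlinear_decay (D := K' * ε) hh0 hp0 hη0 hη1 hK0 hQ0
    (fun r R hr hR => hmono r R hr (by rw [hh] at hR; linarith)) ?_ ?_ ?_ ?_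
  · intro r R hr hrR hR hQR
    have hR1 : R < ρ₁ := by rw [hh] at hR; linarith
    have hc : c R ≤ C₃ * Q R ^ (1 + 2 / p) := by
      rw [hC₃]
      exact le_energy_rpow_of_forall_scale hn hm0 hm1 hp hL hC₁ hC₂ (hb R) (hEQ R hR1)
          (hbQ R hR1) hQR
          fun δ h0 h1 => hscale R δ (by linarith) hR1 h0 h1
    refine (hint r R hr hrR hR1).trans ?_
    refine add_le_add ?_ (le_of_eq (by ring))
    rw [hK, mul_assoc]
    refine mul_le_mul_of_nonneg_left ?_ hM.le
    exact sqrt_mul_le_of_superlinear hp0 hC₃0 (hE R) (hEQ R hR1) hc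
  -- Initial bound: ρ₀ + h is the midpoint of [ρ₀, ρ₁], and the integrated inequality is used
  -- between it and ρ₀ + 3h/2, still below ρ₁.
  · have hR' : ρ₀ + 3 / 2 * h < ρ₁ := by rw [hh]; linarith
    obtain ⟨R', hR'd⟩ : ∃ x : ℝ, x = ρ₀ + 3 / 2 * h := ⟨_, rfl⟩
    rw [← hR'd] at hR'
    have h1 := hint (ρ₀ + h) R' (by linarith) (by linarith) hR'
    have hER1 : E R' ≤ 1 := (hEs R' hR').trans (min_le_left _ _)
    have hER2 : E R' ≤ (A / (1 + s)) ^ 2 := (hEs R' hR').trans (min_le_right _ _)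
    have hcR : c R' ≤ C₄ * (1 + s) ^ 2 := by
      rw [hC₄]
      exact le_one_add_sq_of_scale_half hm0 hm1 hC₁ hC₂ hs hER1 (hb R') (hbs R' hR')
        (hscale R' (1 / 2) (by linarith) hR' (by norm_num) le_rfl)
    have hsq : √(c R' * E R') ≤ √C₄ * A := by
      have : √(C₄ * (1 + s) ^ 2 * (A / (1 + s)) ^ 2) = √C₄ * A := by
        rw [show C₄ * (1 + s) ^ 2 * (A / (1 + s)) ^ 2 = C₄ * A ^ 2 by field_simp,
          Real.sqrt_mul hC₄0, Real.sqrt_sq hA0.le]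
      rw [← this]
      refine Real.sqrt_le_sqrt (mul_le_mul hcR hER2 (hE R') (by positivity))
    have hMA : M * (√C₄ * A) ≤ η * h / 4 := by
      have : M * ((√C₄ + 1) * A) = η * h / 4 := by rw [hA]; field_simp
      rw [← this]
      gcongr
      exact (lt_add_one _).le
    have hsrc : K' * (h / 2) * (ε * (3 / 2 * h) ^ p) ≤ h / 2 * (η / 2) := by
      calc K' * (h / 2) * (ε * (3 / 2 * h) ^ p) ≤ K' * (h / 2) * (ε * (2 * h) ^ p) := by
            gcongr; norm_num
        _ = h / 2 * (K' * ε * (2 * h) ^ p) := by ring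
        _ ≤ h / 2 * (η / 2) := by
            rw [hεK]
            have := mul_le_of_le_one_right hη0.le hl1.le
            gcongr
    rw [show R' - (ρ₀ + h) = h / 2 by rw [hR'd]; ring, show R' - ρ₀ = 3 / 2 * h by rw [hR'd]; ring]
      at h1
    refine le_of_mul_le_mul_left (a := h / 2) ?_ (by positivity)
    calc _ ≤ _ := h1
      _ ≤ η * h / 4 + h / 2 * (η / 2) :=
          add_le_add ((mul_le_mul_of_nonneg_left hsq hM.le).trans hMA) hsrc
      _ = _ := by ring
  · rw [← hl]
    calc K * η ^ (1 / p) ≤ (K + 1) * (l * h / (4 * (K + 1))) := by gcongr; linarith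
      _ = _ := by field_simp
  · rw [← hl]
    calc K' * ε * h ^ p ≤ K' * ε * (2 * h) ^ p := by gcongr; linarith
      _ = _ := hεK

/-! ### The local energy and its integrated inequality -/

section Energy

variable {N : ℕ}

theorem ballNorm_two_sq {V : Type*} [NormedAddCommGroup V] (f : EuclideanSpace ℝ (Fin N) → V)
    (x₀ : EuclideanSpace ℝ (Fin N)) (ρ : ℝ) :
    ballNorm f 2 x₀ ρ ^ 2 = ∫⁻ x in ball x₀ ρ, ‖f x‖ₑ ^ 2 := by
  rw [ballNorm, ENNReal.ofReal_ofNat, eLpNorm_eq_lintegral_rpow_enorm_toReal two_ne_zero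
    ENNReal.ofNat_ne_top, ← ENNReal.rpow_natCast, ← ENNReal.rpow_mul]
  simp

theorem ballNorm_rpow {V : Type*} [NormedAddCommGroup V] (f : EuclideanSpace ℝ (Fin N) → V)
    {q : ℝ} (hq : 0 < q) (x₀ : EuclideanSpace ℝ (Fin N)) (ρ : ℝ) :
    ballNorm f q x₀ ρ ^ q = ∫⁻ x in ball x₀ ρ, ‖f x‖ₑ ^ q := by
  rw [ballNorm, eLpNorm_eq_lintegral_rpow_enorm_toReal (by simpa) ENNReal.ofReal_ne_top,
    ENNReal.toReal_ofReal hq.le, ← ENNReal.rpow_mul, one_div_mul_cancel hq.ne', ENNReal.rpow_one]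

variable {u F : EuclideanSpace ℝ (Fin N) → ℂ}
  {G : EuclideanSpace ℝ (Fin N) → EuclideanSpace ℂ (Fin N)}
  {x₀ : EuclideanSpace ℝ (Fin N)} {r R ρ₁ : ℝ}

theorem enorm_flux_integrand_le (x : EuclideanSpace ℝ (Fin N)) :
    ‖u x * ∑ i, conj (G x i) * (((x - x₀) i / ‖x - x₀‖ : ℝ) : ℂ)‖ₑ ≤ ‖u x‖ₑ * ‖G x‖ₑ := by
  rw [enorm_mul]
  gcongr
  have h := norm_sum_ofReal_mul_le (‖x - x₀‖⁻¹ • (x - x₀)) (G x)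
  have h1 : ‖‖x - x₀‖⁻¹ • (x - x₀)‖ ≤ 1 := by
    rw [norm_smul, norm_inv, norm_norm]
    exact inv_mul_le_one
  have h2 : ∑ i, conj (G x i) * (((x - x₀) i / ‖x - x₀‖ : ℝ) : ℂ) =
      conj (∑ i, (((‖x - x₀‖⁻¹ • (x - x₀)) i : ℝ) : ℂ) * G x i) := by
    rw [map_sum]
    refine Finset.sum_congr rfl fun i _ => ?_
    rw [map_mul, Complex.conj_ofReal, mul_comm, PiLp.smul_apply, smul_eq_mul, div_eq_inv_mul]
  rw [h2, ← ofReal_norm, ← ofReal_norm, RCLike.norm_conj]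
  exact ENNReal.ofReal_le_ofReal (h.trans (mul_le_of_le_one_left (norm_nonneg _) h1))

theorem enorm_boundaryFlux_le {ρ : ℝ} (hρ : 0 ≤ ρ) :
    ‖boundaryFlux u G x₀ ρ‖ₑ ≤ ENNReal.ofReal (ρ ^ (N - 1)) *
      ∫⁻ ξ : sphere (0 : EuclideanSpace ℝ (Fin N)) 1,
        ‖u (x₀ + ρ • (ξ : EuclideanSpace ℝ (Fin N)))‖ₑ *
          ‖G (x₀ + ρ • (ξ : EuclideanSpace ℝ (Fin N)))‖ₑ
          ∂(volume : Measure (EuclideanSpace ℝ (Fin N))).toSphere := by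
  rw [boundaryFlux, sphereIntegral, enorm_smul, Real.enorm_of_nonneg (by positivity)]
  gcongr
  refine (enorm_integral_le_lintegral_enorm _).trans (lintegral_mono fun ξ => ?_)
  exact enorm_flux_integrand_le _

/-- Polar coordinates: integrating the sphere bounds over the radii gives a volume integral over an
annulus, enlarged here to the ball. -/
theorem lintegral_boundaryFlux_le (hN : 1 ≤ N) (hr : 0 ≤ r)
    (hu : AEMeasurable (fun x => ‖u x‖ₑ * ‖G x‖ₑ) (volume.restrict (ball x₀ R))) :
    ∫⁻ ρ in Ioo r R, ‖boundaryFlux u G x₀ ρ‖ₑ ≤ ∫⁻ x in ball x₀ R, ‖u x‖ₑ * ‖G x‖ₑ := by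
  have : Nonempty (Fin N) := ⟨⟨0, hN⟩⟩
  set g : EuclideanSpace ℝ (Fin N) → ℝ≥0∞ :=
    (ball x₀ R).indicator fun x => ‖u x‖ₑ * ‖G x‖ₑ with hg
  have hgm : AEMeasurable g := (aemeasurable_indicator_iff measurableSet_ball).2 hu
  have hgm' : AEMeasurable (fun x => g (x₀ + x)) :=
    hgm.comp_quasiMeasurePreserving (measurePreserving_add_left volume x₀).quasiMeasurePreserving
  have hpolar := lintegral_eq_lintegral_Ioi_toSphere volume hgm'
  rw [lintegral_add_left_eq_self g x₀, finrank_euclideanSpace_fin] at hpolar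
  rw [← lintegral_indicator measurableSet_ball, ← hg, hpolar]
  refine le_trans (setLIntegral_mono' measurableSet_Ioo fun ρ hρ => ?_)
    (lintegral_mono_set fun ρ hρ => hr.trans_lt hρ.1)
  refine (enorm_boundaryFlux_le (hr.trans hρ.1.le)).trans ?_
  refine mul_le_mul_right (le_of_eq (lintegral_congr fun ξ => ?_)) _
  have hmem : x₀ + ρ • (ξ : EuclideanSpace ℝ (Fin N)) ∈ ball x₀ R := by
    rw [mem_ball, dist_eq_norm, add_sub_cancel_left, norm_smul, norm_eq_of_mem_sphere,
      Real.norm_of_nonneg (hr.trans hρ.1.le), mul_one]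
    exact hρ.2
  rw [hg, indicator_of_mem hmem]

/-- Expand (L|b| - M|a|)² ≥ 0; the weight L/2 on |b|² is half of what the energy inequality can
absorb. -/
theorem young_enorm {L M : ℝ} (hL : 0 < L) (hM : 0 < M) (a b : ℂ) :
    ENNReal.ofReal M * ‖a * b‖ₑ ≤
      ENNReal.ofReal (L / 2) * ‖b‖ₑ ^ 2 + ENNReal.ofReal (M ^ 2 / (2 * L)) * ‖a‖ₑ ^ 2 := by
  rw [← ofReal_norm, ← ofReal_norm, ← ofReal_norm, ← ENNReal.ofReal_pow (norm_nonneg _),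
    ← ENNReal.ofReal_pow (norm_nonneg _), ← ENNReal.ofReal_mul hM.le,
    ← ENNReal.ofReal_mul (by positivity), ← ENNReal.ofReal_mul (by positivity),
    ← ENNReal.ofReal_add (by positivity) (by positivity), norm_mul]
  refine ENNReal.ofReal_le_ofReal ?_
  have h : 0 ≤ (L * ‖b‖ - M * ‖a‖) ^ 2 / (2 * L) := by positivity
  have h2 : (L * ‖b‖ - M * ‖a‖) ^ 2 / (2 * L) =
      L / 2 * ‖b‖ ^ 2 + M ^ 2 / (2 * L) * ‖a‖ ^ 2 - M * (‖a‖ * ‖b‖) := by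
    field_simp
    ring
  linarith

/-- The energy on the ball of radius `ρ`. -/
noncomputable def ballEnergy (m L : ℝ) (u : EuclideanSpace ℝ (Fin N) → ℂ)
    (G : EuclideanSpace ℝ (Fin N) → EuclideanSpace ℂ (Fin N)) (x₀ : EuclideanSpace ℝ (Fin N))
    (ρ : ℝ) : ℝ≥0∞ :=
  (∫⁻ x in ball x₀ ρ, ‖G x‖ₑ ^ 2) + ENNReal.ofReal L * (∫⁻ x in ball x₀ ρ, ‖u x‖ₑ ^ (1 + m)) +
    ENNReal.ofReal (L / 2) * ∫⁻ x in ball x₀ ρ, ‖u x‖ₑ ^ 2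

theorem ballEnergy_mono {m L : ℝ} (h : r ≤ R) :
    ballEnergy m L u G x₀ r ≤ ballEnergy m L u G x₀ R := by
  have := ball_subset_ball (x := x₀) h
  unfold ballEnergy
  gcongr

/-- The source term is absorbed into the left-hand side of the local energy inequality. -/
theorem LocalEnergyInequality.ballEnergy_le {m L M ρ : ℝ} (hm : 0 < m) (hL : 0 < L) (hM : 0 < M)
    (h : LocalEnergyInequality m L M F u G x₀ ρ)
    (hF : AEMeasurable (fun x => ‖F x‖ₑ ^ 2) (volume.restrict (ball x₀ ρ)))
    (hc : ∫⁻ x in ball x₀ ρ, ‖u x‖ₑ ^ 2 ≠ ⊤) :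
    ballEnergy m L u G x₀ ρ ≤ ENNReal.ofReal M * ‖boundaryFlux u G x₀ ρ‖ₑ +
      ENNReal.ofReal (M ^ 2 / (2 * L)) * ∫⁻ x in ball x₀ ρ, ‖F x‖ₑ ^ 2 := by
  rw [LocalEnergyInequality, ballNorm_two_sq, ballNorm_two_sq, ballNorm_rpow u (by linarith),
    add_comm m 1, mul_add] at h
  set c := ∫⁻ x in ball x₀ ρ, ‖u x‖ₑ ^ 2 with hcdef
  have hsrc : ENNReal.ofReal M * ∫⁻ x in ball x₀ ρ, ‖F x * u x‖ₑ ≤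
      ENNReal.ofReal (L / 2) * c +
        ENNReal.ofReal (M ^ 2 / (2 * L)) * ∫⁻ x in ball x₀ ρ, ‖F x‖ₑ ^ 2 := by
    rw [← lintegral_const_mul' _ _ ENNReal.ofReal_ne_top,
      hcdef, ← lintegral_const_mul' _ _ ENNReal.ofReal_ne_top,
      ← lintegral_const_mul' _ _ ENNReal.ofReal_ne_top, ← lintegral_add_right' _ (hF.const_mul _)]
    exact lintegral_mono fun x => young_enorm hL hM _ _
  have hLc : ENNReal.ofReal L * c = ENNReal.ofReal (L / 2) * c + ENNReal.ofReal (L / 2) * c := by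
    rw [← add_mul, ← ENNReal.ofReal_add (by positivity) (by positivity), add_halves]
  have hfin : ENNReal.ofReal (L / 2) * c ≠ ⊤ := ENNReal.mul_ne_top ENNReal.ofReal_ne_top hc
  rw [hLc] at h
  -- Cancelling (L/2) c on both sides is legitimate only because c is finite.
  refine (ENNReal.add_le_add_iff_right hfin).1 ?_
  unfold ballEnergy
  calc _ = _ := add_assoc _ _ _
    _ ≤ _ := h
    _ ≤ _ := add_le_add_right hsrc _
    _ = _ := by rw [add_comm (ENNReal.ofReal (L / 2) * c), add_assoc]

/-- The energy inequality integrated over the radii in `(r, R)`. -/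
theorem ballEnergy_mul_sub_le {m L M : ℝ} (hN : 1 ≤ N) (hm : 0 < m) (hL : 0 < L) (hM : 0 < M)
    (hr : 0 < r) (hRρ : R < ρ₁) (h : IsH1Loc (ball x₀ ρ₁) u G)
    (hF : MemLp F 2 (volume.restrict (ball x₀ ρ₁)))
    (hE : ∀ᵐ ρ ∂(volume.restrict (Ioo 0 ρ₁)), LocalEnergyInequality m L M F u G x₀ ρ) :
    ENNReal.ofReal (R - r) * ballEnergy m L u G x₀ r ≤
      ENNReal.ofReal M * ((∫⁻ x in ball x₀ R, ‖u x‖ₑ ^ 2) *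
        ∫⁻ x in ball x₀ R, ‖G x‖ₑ ^ 2) ^ (1 / 2 : ℝ) +
      ENNReal.ofReal (M ^ 2 / (2 * L)) * ENNReal.ofReal (R - r) *
        ∫⁻ x in ball x₀ R, ‖F x‖ₑ ^ 2 := by
  have hsub : closedBall x₀ R ⊆ ball x₀ ρ₁ := closedBall_subset_ball hRρ
  have hu := h.memL2Loc _ (isCompact_closedBall _ _) hsub
  have hG := h.grad_memL2Loc _ (isCompact_closedBall _ _) hsub
  have hum : AEMeasurable (fun x => ‖u x‖ₑ) (volume.restrict (ball x₀ R)) :=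
    (hu.1.mono_set ball_subset_closedBall).enorm
  have hGm : AEMeasurable (fun x => ‖G x‖ₑ) (volume.restrict (ball x₀ R)) :=
    (hG.1.mono_set ball_subset_closedBall).enorm
  have hc : ∫⁻ x in ball x₀ R, ‖u x‖ₑ ^ 2 < ⊤ := by
    have h3 := lintegral_rpow_enorm_lt_top_of_eLpNorm_lt_top two_ne_zero ENNReal.ofNat_ne_top hu.2
    refine (lintegral_mono_set ball_subset_closedBall).trans_lt ?_
    simpa using h3
  set f := ∫⁻ x in ball x₀ R, ‖F x‖ₑ ^ 2 with hf
  have hsubI : Ioo r R ⊆ Ioo 0 ρ₁ := Ioo_subset_Ioo hr.le hRρ.le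
  have hpt : ∀ᵐ ρ ∂(volume.restrict (Ioo r R)), ballEnergy m L u G x₀ r ≤
      ENNReal.ofReal M * ‖boundaryFlux u G x₀ ρ‖ₑ + ENNReal.ofReal (M ^ 2 / (2 * L)) * f := by
    filter_upwards [ae_restrict_of_ae_restrict_of_subset hsubI hE,
      ae_restrict_mem measurableSet_Ioo] with ρ hρE hρ
    have hρR : ball x₀ ρ ⊆ ball x₀ R := ball_subset_ball hρ.2.le
    have h1 := hρE.ballEnergy_le hm hL hM
      ((hF.1.mono_set (hρR.trans (ball_subset_ball hRρ.le))).enorm.pow_const 2)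
      ((lintegral_mono_set hρR).trans_lt hc).ne
    -- Monotonicity freezes the left side at r and the source at R, so that only the flux depends on
    -- ρ.
    refine (ballEnergy_mono hρ.1.le).trans (h1.trans ?_)
    gcongr
    exact lintegral_mono_set hρR
  have hCS : ∫⁻ x in ball x₀ R, ‖u x‖ₑ * ‖G x‖ₑ ≤
      ((∫⁻ x in ball x₀ R, ‖u x‖ₑ ^ 2) * ∫⁻ x in ball x₀ R, ‖G x‖ₑ ^ 2) ^ (1 / 2 : ℝ) := by
    have h2 := sq_lintegral_mul_le hum hGm
    rw [one_div, ENNReal.le_rpow_inv_iff two_pos]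
    simpa using h2
  calc ENNReal.ofReal (R - r) * ballEnergy m L u G x₀ r
      = ∫⁻ ρ in Ioo r R, ballEnergy m L u G x₀ r := by
        rw [setLIntegral_const, Real.volume_Ioo, mul_comm]
    _ ≤ ∫⁻ ρ in Ioo r R, (ENNReal.ofReal M * ‖boundaryFlux u G x₀ ρ‖ₑ +
          ENNReal.ofReal (M ^ 2 / (2 * L)) * f) := lintegral_mono_ae hpt
    _ = ENNReal.ofReal M * (∫⁻ ρ in Ioo r R, ‖boundaryFlux u G x₀ ρ‖ₑ) +
          ENNReal.ofReal (M ^ 2 / (2 * L)) * ENNReal.ofReal (R - r) * f := by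
        rw [lintegral_add_right _ measurable_const, setLIntegral_const, Real.volume_Ioo,
          lintegral_const_mul' _ _ ENNReal.ofReal_ne_top]
        ring
    _ ≤ _ := by
        gcongr
        exact (lintegral_boundaryFlux_le hN hr.le (hum.mul hGm)).trans hCS

end Energy

/-! ### Passage to real-valued energies and conclusion -/

theorem setLIntegral_rpow_lt_top_of_sq {N : ℕ} {u : EuclideanSpace ℝ (Fin N) → ℂ}
    {x₀ : EuclideanSpace ℝ (Fin N)} {R q : ℝ} (hq0 : 0 ≤ q) (hq2 : q ≤ 2)
    (h : ∫⁻ x in ball x₀ R, ‖u x‖ₑ ^ 2 < ⊤) : ∫⁻ x in ball x₀ R, ‖u x‖ₑ ^ q < ⊤ := by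
  calc ∫⁻ x in ball x₀ R, ‖u x‖ₑ ^ q ≤ ∫⁻ x in ball x₀ R, (1 + ‖u x‖ₑ ^ 2) := by
        refine lintegral_mono fun x => ?_
        rcases le_total ‖u x‖ₑ 1 with h1 | h1
        · exact (ENNReal.rpow_le_one h1 hq0).trans le_self_add
        · calc ‖u x‖ₑ ^ q ≤ ‖u x‖ₑ ^ (2 : ℝ) := ENNReal.rpow_le_rpow_of_exponent_le h1 hq2
            _ = ‖u x‖ₑ ^ 2 := ENNReal.rpow_two _
            _ ≤ _ := le_add_self
    _ = volume (ball x₀ R) + ∫⁻ x in ball x₀ R, ‖u x‖ₑ ^ 2 := by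
        rw [lintegral_add_left measurable_const, setLIntegral_const, one_mul]
    _ < ⊤ := ENNReal.add_lt_top.2 ⟨measure_ball_lt_top, h⟩

/-- The real-valued form of the additive Gagliardo-Nirenberg inequality. -/
theorem IsH1Loc.toReal_setLIntegral_sq_le {N : ℕ} {u : EuclideanSpace ℝ (Fin N) → ℂ}
    {G : EuclideanSpace ℝ (Fin N) → EuclideanSpace ℂ (Fin N)} {x₀ : EuclideanSpace ℝ (Fin N)}
    {m ρ₀ ρ₁ R δ : ℝ} (h : IsH1Loc (ball x₀ R) u G) (hm0 : 0 < m) (hm1 : m < 1) (hρ₀ : 0 < ρ₀)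
    (hR : ρ₀ < R) (hRρ : R ≤ ρ₁) (h0 : 0 < δ) (h1 : δ ≤ 1 / 2)
    (hE : ∫⁻ x in ball x₀ R, ‖G x‖ₑ ^ 2 ≠ ⊤) (hb : ∫⁻ x in ball x₀ R, ‖u x‖ₑ ^ (1 + m) ≠ ⊤) :
    (∫⁻ x in ball x₀ R, ‖u x‖ₑ ^ 2).toReal ≤
      2 * (2 * ρ₁) ^ 2 * 2 ^ N * δ ^ 2 * (∫⁻ x in ball x₀ R, ‖G x‖ₑ ^ 2).toReal +
      2 * 2 ^ N * ((volume (ball (0 : EuclideanSpace ℝ (Fin N)) ρ₀)).toReal⁻¹) ^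
        ((1 - m) / (1 + m)) * (δ ^ (-(N : ℝ)) * (∫⁻ x in ball x₀ R, ‖u x‖ₑ ^ (1 + m)).toReal) ^
          ((1 - m) / (1 + m)) * (∫⁻ x in ball x₀ R, ‖u x‖ₑ ^ (1 + m)).toReal := by
  have key := h.setLIntegral_sq_le hρ₀ hR h0 h1 (q := 1 + m) (by linarith) (by linarith)
  -- Recentring the reference ball at the origin makes the constant independent of x₀.
  rw [show 2 - (1 + m) = 1 - m by ring, Measure.addHaar_ball_center volume x₀ ρ₀] at key
  set e := (1 - m) / (1 + m) with he
  have he0 : 0 ≤ e := div_nonneg (by linarith) (by linarith)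
  set E := ∫⁻ x in ball x₀ R, ‖G x‖ₑ ^ 2 with hEdef
  set b := ∫⁻ x in ball x₀ R, ‖u x‖ₑ ^ (1 + m) with hbdef
  set V := volume (ball (0 : EuclideanSpace ℝ (Fin N)) ρ₀) with hV
  have hV0 : V⁻¹ ≠ ⊤ := ENNReal.inv_ne_top.2 (measure_ball_pos _ _ hρ₀).ne'
  have hpow : (V⁻¹ * ENNReal.ofReal ((δ ^ N)⁻¹) * b) ^ e ≠ ⊤ :=
    ENNReal.rpow_ne_top_of_nonneg he0 (by finiteness)
  have hX : 2 * (ENNReal.ofReal (2 * R * δ) ^ 2 * 2 ^ N * E) ≠ ⊤ := by finiteness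
  have hY : 2 * ((V⁻¹ * ENNReal.ofReal ((δ ^ N)⁻¹) * b) ^ e * (2 ^ N * b)) ≠ ⊤ := by finiteness
  have hR0 : 0 < R := hρ₀.trans hR
  have key' := ENNReal.toReal_mono (ENNReal.add_ne_top.2 ⟨hX, hY⟩) key
  rw [ENNReal.toReal_add hX hY] at key'
  simp only [ENNReal.toReal_mul, ENNReal.toReal_pow, ← ENNReal.toReal_rpow, ENNReal.toReal_inv,
    ENNReal.toReal_ofNat] at key'
  rw [ENNReal.toReal_ofReal (by positivity), ENNReal.toReal_ofReal (by positivity)] at key'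
  refine key'.trans (add_le_add ?_ (le_of_eq ?_))
  · calc _ = 2 * (2 * R) ^ 2 * 2 ^ N * δ ^ 2 * E.toReal := by ring
      _ ≤ _ := by gcongr
  · rw [Real.rpow_neg h0.le, Real.rpow_natCast, mul_assoc V.toReal⁻¹,
      Real.mul_rpow (by positivity) (by positivity)]
    ring

theorem theorem2p2 (N : ℕ) (hN : 1 ≤ N) (m : ℝ) (hm0 : 0 < m) (hm1 : m < 1)
    (ρ₀ ρ₁ : ℝ) (hρ₀ : 0 < ρ₀) (hρ₁ : ρ₀ < ρ₁) (L M : ℝ) (hL : 0 < L) (hM : 0 < M) :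
    ∃ Estar εstar : ℝ≥0∞ → ℝ,
      (∀ s, 0 < Estar s) ∧ (∀ s, 0 < εstar s) ∧
      AntitoneOn Estar {s | s ≠ ⊤} ∧ AntitoneOn εstar {s | s ≠ ⊤} ∧
      ∀ (x₀ : EuclideanSpace ℝ (Fin N)) (F u : EuclideanSpace ℝ (Fin N) → ℂ)
        (Du : EuclideanSpace ℝ (Fin N) → EuclideanSpace ℂ (Fin N)),
        MemLp F 2 (volume.restrict (ball x₀ ρ₁)) →
        IsH1Loc (ball x₀ ρ₁) u Du →
        (∀ᵐ ρ ∂(volume.restrict (Ioo 0 ρ₁)), LocalEnergyInequality m L M F u Du x₀ ρ) →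
        ballNorm Du 2 x₀ ρ₁ ^ 2 < ENNReal.ofReal (Estar (ballNorm u (m + 1) x₀ ρ₁)) →
        (∀ ρ ∈ Ioo 0 ρ₁, ballNorm F 2 x₀ ρ ^ 2 ≤
          ENNReal.ofReal (εstar (ballNorm u (m + 1) x₀ ρ₁) *
            max (ρ - ρ₀) 0 ^ ((2 * (1 + m) + N * (1 - m)) / (1 - m)))) →
        u =ᵐ[volume.restrict (ball x₀ ρ₀)] 0 := by
  obtain ⟨Es, ε, hEs0, hε0, hEsA, hmain⟩ := exists_thresholds (n := N) (ρ₀ := ρ₀) (ρ₁ := ρ₁)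
    (C₁ := 2 * (2 * ρ₁) ^ 2 * 2 ^ N)
    (C₂ := 2 * 2 ^ N * ((volume (ball (0 : EuclideanSpace ℝ (Fin N)) ρ₀)).toReal⁻¹) ^
      ((1 - m) / (1 + m))) N.cast_nonneg hm0 hm1 rfl hρ₁ hL hM (by positivity) (by positivity)
  -- At s = ⊤ the threshold takes the default value Es 0. This is harmless, as the gradient
  -- assumption forces s to be finite.
  refine ⟨fun s => Es s.toReal, fun _ => ε, fun s => hEs0 _ ENNReal.toReal_nonneg, fun _ => hε0,
    fun s _ t ht hst => hEsA ENNReal.toReal_nonneg ENNReal.toReal_nonneg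
      (ENNReal.toReal_mono ht hst), fun _ _ _ _ _ => le_rfl, ?_⟩
  intro x₀ F u Du hF hu hEn hsmall hFs
  rw [ballNorm_two_sq] at hsmall
  have hpos : 0 < ρ₁ := hρ₀.trans hρ₁
  have hEt : ∫⁻ x in ball x₀ ρ₁, ‖Du x‖ₑ ^ 2 < ⊤ := hsmall.trans ENNReal.ofReal_lt_top
  -- A finite gradient energy alone gives u ∈ L² up to the boundary, hence finiteness of the L^(1+m)
  -- norm and of every energy below.
  have hct : ∫⁻ x in ball x₀ ρ₁, ‖u x‖ₑ ^ 2 < ⊤ := hu.setLIntegral_sq_lt_top hpos hEt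
  have hbt : ∫⁻ x in ball x₀ ρ₁, ‖u x‖ₑ ^ (1 + m) < ⊤ :=
    setLIntegral_rpow_lt_top_of_sq (by linarith) (by linarith) hct
  have hsub : ∀ {r : ℝ}, r ≤ ρ₁ → ball x₀ r ⊆ ball x₀ ρ₁ := fun h => ball_subset_ball h
  have hEr : ∀ r ≤ ρ₁, ∫⁻ x in ball x₀ r, ‖Du x‖ₑ ^ 2 ≠ ⊤ := fun r hr =>
    ((lintegral_mono_set (hsub hr)).trans_lt hEt).ne
  have hcr : ∀ r ≤ ρ₁, ∫⁻ x in ball x₀ r, ‖u x‖ₑ ^ 2 ≠ ⊤ := fun r hr =>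
    ((lintegral_mono_set (hsub hr)).trans_lt hct).ne
  have hbr : ∀ r ≤ ρ₁, ∫⁻ x in ball x₀ r, ‖u x‖ₑ ^ (1 + m) ≠ ⊤ := fun r hr =>
    ((lintegral_mono_set (hsub hr)).trans_lt hbt).ne
  have hQr : ∀ r ≤ ρ₁, ballEnergy m L u Du x₀ r ≠ ⊤ := fun r hr => by
    have := hEr r hr
    have := hcr r hr
    have := hbr r hr
    unfold ballEnergy
    finiteness
  have hvanish := hmain (fun r => (∫⁻ x in ball x₀ r, ‖Du x‖ₑ ^ 2).toReal)
    (fun r => (∫⁻ x in ball x₀ r, ‖u x‖ₑ ^ (1 + m)).toReal)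
    (fun r => (∫⁻ x in ball x₀ r, ‖u x‖ₑ ^ 2).toReal)
    (fun r => (ballEnergy m L u Du x₀ r).toReal)
    (ballNorm u (m + 1) x₀ ρ₁).toReal ENNReal.toReal_nonneg (fun _ => ENNReal.toReal_nonneg)
    (fun _ => ENNReal.toReal_nonneg) (fun _ => ENNReal.toReal_nonneg)
    (fun r hr => ENNReal.toReal_mono (hQr r hr.le)
      ((le_self_add).trans le_self_add))
    (fun r hr => by
      rw [← ENNReal.toReal_ofReal hL.le, ← ENNReal.toReal_mul, ENNReal.toReal_ofReal hL.le]
      exact ENNReal.toReal_mono (hQr r hr.le) (le_add_self.trans le_self_add))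
    (fun r R hrR hR => ENNReal.toReal_mono (hQr R hR.le) (ballEnergy_mono hrR))
    (fun R hR => ENNReal.toReal_le_of_le_ofReal (hEs0 _ ENNReal.toReal_nonneg).le
      ((lintegral_mono_set (hsub hR.le)).trans hsmall.le))
    (fun R hR => by
      rw [ENNReal.toReal_rpow, add_comm 1 m, ballNorm_rpow u (by linarith), add_comm m 1]
      exact ENNReal.toReal_mono hbt.ne (lintegral_mono_set (hsub hR.le)))
    (fun R δ hR hR1 h0 h1 => (hu.mono measurableSet_ball (hsub hR1.le)).toReal_setLIntegral_sq_le
      hm0 hm1 hρ₀ hR hR1.le h0 h1 (hEr R hR1.le) (hbr R hR1.le))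
    (fun r R hr hrR hR => by
      have hRr : 0 < R - r := sub_pos.2 hrR
      have key := ballEnergy_mul_sub_le hN hm0 hL hM (hρ₀.trans_le hr) hR hu hF hEn
      have hFR := hFs R ⟨(hρ₀.trans_le hr).trans hrR, hR⟩
      rw [ballNorm_two_sq, max_eq_left (by linarith)] at hFR
      replace key := key.trans (add_le_add_right (mul_le_mul_right hFR _) _)
      have hsq : ENNReal.ofReal M * ((∫⁻ x in ball x₀ R, ‖u x‖ₑ ^ 2) *
          ∫⁻ x in ball x₀ R, ‖Du x‖ₑ ^ 2) ^ (1 / 2 : ℝ) ≠ ⊤ :=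
        ENNReal.mul_ne_top ENNReal.ofReal_ne_top (ENNReal.rpow_ne_top_of_nonneg (by norm_num)
          (ENNReal.mul_ne_top (hcr R hR.le) (hEr R hR.le)))
      have key' := ENNReal.toReal_mono (by finiteness) key
      rw [ENNReal.toReal_add hsq (by finiteness)] at key'
      simp only [ENNReal.toReal_mul, ← ENNReal.toReal_rpow] at key'
      have hRρ : 0 < R - ρ₀ := by linarith
      rwa [ENNReal.toReal_ofReal hRr.le, ENNReal.toReal_ofReal hM.le,
        ENNReal.toReal_ofReal (by positivity), ENNReal.toReal_ofReal (by positivity),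
        ← Real.sqrt_eq_rpow] at key')
  have hQ0 : ballEnergy m L u Du x₀ ρ₀ = 0 :=
    ((ENNReal.toReal_eq_zero_iff _).1 (le_antisymm hvanish ENNReal.toReal_nonneg)).resolve_right
      (hQr ρ₀ hρ₁.le)
  have hc0 : ∫⁻ x in ball x₀ ρ₀, ‖u x‖ₑ ^ 2 = 0 := by
    unfold ballEnergy at hQ0
    have h2 := (add_eq_zero.1 hQ0).2
    exact (mul_eq_zero.1 h2).resolve_left (by simpa using hL)
  have hm : AEMeasurable (fun x => ‖u x‖ₑ ^ 2) (volume.restrict (ball x₀ ρ₀)) :=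
    (((hu.memL2Loc _ (isCompact_closedBall _ _) (closedBall_subset_ball hρ₁)).1.mono_set
      ball_subset_closedBall).enorm).pow_const 2
  filter_upwards [(lintegral_eq_zero_iff' hm).1 hc0] with x hx
  simpa using hx
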